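/- All graphs are finite, undirected and loopless. A separation of a graph $G$ is a pair $(G_1,G_2)$ of subgraphs with $V(G_1)\cup V(G_2)=V(G)$ and no edge of $G$ between $V(G_1)\setminus V(G_2)$ and $V(G_2)\setminus V(G_1)$; its order is $|V(G_1)\cap V(G_2)|$. $G$ is $(L,p)$-unbreakable if every separation of order at most $p$ satisfies $|V(G_1)|\le L$ or $|V(G_2)|\le L$. $\mathsf{DP}_j[(s_1,t_1),\dots,(s_j,t_j)]$ holds in $G$ if there are paths $P_i$ from $s_i$ to $t_i$ ($1\le i\le j$) such that for $i\ne i'$ no vertex of $P_i$ is an internal vertex of $P_{i'}$. Let $h\in\mathbb N$ and let $\Lambda\subset\mathbb N$ be finite. A rooted colored graph (with $h$ colors and root labels $\Lambda$) is a graph $G$ with $h$ vertex sets (the colors) and distinct root vertices, exactly one for each label in $\Lambda$. Let $k,r\in\mathbb N$. For a tuple $\bar v\in (V(G)\cup\{\bot\})^m$, $\mathsf{pattern}(G,\bar v)$ is the set of all atomic formulas in $m$ variables that hold for $\bar v$, where the atomic formulas are equality, adjacency, membership in a color, and $\mathsf{DP}_j$ with $1\le j\le k$, applied to variables and root labels;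 apart from equality, an atomic formula with an argument of value $\bot$ is false. For $R\subseteq V(G)$ put $\mathsf{sig}^0(G,R,\bar v)=\mathsf{pattern}(G,\bar v)$ and $\mathsf{sig}^{i}(G,R,\bar v)=\{\mathsf{sig}^{i-1}(G,R,\bar v u): u\in R\cup\{\bot\}\}$ for $i\ge 1$, and let $\mathsf{sig}^r(G,R)=\mathsf{sig}^r(G,R,())$ for the empty tuple $()$. Let $q\colon\mathbb N\to\mathbb N$ be any function, and let $p=4k^3$, $L=q(p)$ and $t=\max\{6k^3,2kL\}$. Let $\mathscr C$ be the class of all rooted colored graphs, with $h$ colors and root labels $\Lambda$, that are $(L,p)$-unbreakable and contain $K_t$ as a minor. Then patterns and signatures are uniformly $\mathsf{FO}$-definable on $\mathscr C$: 1. For every set $\tau$ of atomic formulas in $r$ variables there is a first-order formula $\varphi_\tau(x_1,\dots,x_r)$ (without disjoint-paths predicates) over the vocabulary consisting of the edge relation, the colors, and a unary predicate for each root label, such that for all $G\in\mathscr C$ and all $v_1,\dots,v_r\in V(G)$: $G\models\varphi_\tau(v_1,\dots,v_r)$ if and only if $\mathsf{pattern}(G,v_1,\dots,v_r)=\tau$.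 2. For every possible value $\sigma$ of $\mathsf{sig}^r$ there is a first-order sentence $\varphi_\sigma$ over the same vocabulary with an additional unary predicate for $R$, such that for all $G\in\mathscr C$ and all $R\subseteq V(G)$: $(G,R)\models\varphi_\sigma$ if and only if $\mathsf{sig}^r(G,R)=\sigma$. -/

import Mathlib

/-! Graphs, unbreakability, clique minors, disjoint-paths predicates, patterns and signatures of
rooted coloured graphs, and the first-order vocabulary in which they are to be defined. -/

universe u

namespace DPLogic

/-! ### Unbreakability and minors -/

/-- `(G₁, G₂)` is a separation of `G`. -/
structure IsSeparation {V : Type u} (G : SimpleGraph V) (G₁ G₂ : G.Subgraph) : Prop where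
  cover : G₁.verts ∪ G₂.verts = Set.univ
  no_edge : ∀ a ∈ G₁.verts \ G₂.verts, ∀ b ∈ G₂.verts \ G₁.verts, ¬ G.Adj a b

/-- The subgraph `H` is `(q, k)`-unbreakable in `G`. -/
def UnbreakableIn {V : Type u} (G : SimpleGraph V) (H : G.Subgraph) (q k : ℕ) : Prop :=
  ∀ G₁ G₂ : G.Subgraph, IsSeparation G G₁ G₂ → (G₁.verts ∩ G₂.verts).ncard ≤ k →
    (G₁.verts ∩ H.verts).ncard ≤ q ∨ (G₂.verts ∩ H.verts).ncard ≤ q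

/-- `G` is `(q, k)`-unbreakable (in itself). -/
def Unbreakable {V : Type u} (G : SimpleGraph V) (q k : ℕ) : Prop :=
  UnbreakableIn G ⊤ q k

/-- `H` is a minor of `G`: there is a minor model of `H` in `G`, that is, a family of pairwise
disjoint (nonempty) connected branch sets, one for each vertex of `H`, with an edge of `G` between
the branch sets of any two adjacent vertices of `H`. -/
def IsMinor {W : Type*} {V : Type u} (H : SimpleGraph W) (G : SimpleGraph V) : Prop :=
  ∃ B : W → Set V,
    (∀ a, (G.induce (B a)).Connected) ∧
    (∀ a b, a ≠ b → Disjoint (B a) (B b)) ∧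
    (∀ a b, H.Adj a b → ∃ x ∈ B a, ∃ y ∈ B b, G.Adj x y)

/-! ### Disjoint paths -/

/-- The internal vertices of a path: its vertices other than the two endpoints. -/
def internalVerts {V : Type u} {G : SimpleGraph V} {a b : V} (P : G.Walk a b) : Set V :=
  {x | x ∈ P.support ∧ x ≠ a ∧ x ≠ b}

/-- `DP_j[(s₁, t₁), …, (s_j, t_j)]` holds in `G`: there are paths from `sᵢ` to `tᵢ` such that no
vertex of one of them is an internal vertex of another one. -/
def DP {V : Type u} (G : SimpleGraph V) {j : ℕ} (s t : Fin j → V) : Prop :=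
  ∃ P : ∀ i, G.Walk (s i) (t i), (∀ i, (P i).IsPath) ∧
    ∀ i i', i ≠ i' → ∀ x ∈ (P i).support, x ∉ internalVerts (P i')

/-! ### Rooted coloured graphs, patterns and signatures -/

/-- A graph on `V` with `h` colours (arbitrary vertex sets) and with roots labelled bijectively by
the finite set `Λ` of labels: `root` is the inverse of the injective labelling
`ρ : R(G) → ℕ` with image `Λ`, and `R(G)` is the range of `root`. -/
structure RootedGraph (h : ℕ) (Λ : Finset ℕ) (V : Type u) where
  graph : SimpleGraph V
  color : Fin h → Set V
  root : Λ ↪ V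

/-- What an atomic formula can speak about: one of `r` variables, or the root with a given label. -/
inductive Arg (r : ℕ) (Λ : Finset ℕ) : Type
  | var (i : Fin r) : Arg r Λ
  | root (c : Λ) : Arg r Λ

/-- Atomic formulas in `r` variables of first-order logic with disjoint-paths predicates over
graphs with `h` colours and roots labelled by `Λ`, where the disjoint-paths predicates are
`DP_1, …, DP_k`. -/
inductive Atom (k h : ℕ) (Λ : Finset ℕ) (r : ℕ) : Type
  | eq (a b : Arg r Λ) : Atom k h Λ r
  | edge (a b : Arg r Λ) : Atom k h Λ r
  | color (i : Fin h) (a : Arg r Λ) : Atom k h Λ r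
  | dp (j : ℕ) (one_le : 1 ≤ j) (le : j ≤ k) (s t : Fin j → Arg r Λ) : Atom k h Λ r

/-- The value of an argument under a valuation of the variables in `V(G) ∪ {⊥}`, where `⊥` is
`none`. -/
def Arg.val {h r : ℕ} {Λ : Finset ℕ} {V : Type u} (G : RootedGraph h Λ V) (v : Fin r → Option V) :
    Arg r Λ → Option V
  | .var i => v i
  | .root c => some (G.root c)

/-- Truth of an atomic formula. Equality is equality in `V(G) ∪ {⊥}`; the edge relation, the
colours and the disjoint-paths predicates only hold of vertices. -/
def Atom.Holds {k h r : ℕ} {Λ : Finset ℕ} {V : Type u} (G : RootedGraph h Λ V)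
    (v : Fin r → Option V) : Atom k h Λ r → Prop
  | .eq a b => a.val G v = b.val G v
  | .edge a b => ∃ x y, a.val G v = some x ∧ b.val G v = some y ∧ G.graph.Adj x y
  | .color i a => ∃ x, a.val G v = some x ∧ x ∈ G.color i
  | .dp j _ _ s t => ∃ x y : Fin j → V, (∀ i, (s i).val G v = some (x i)) ∧
      (∀ i, (t i).val G v = some (y i)) ∧ DP G.graph x y

/-- `pattern(G, v)`: the atomic type of the tuple `v`, as the set of atomic formulas true of it. -/
def pattern (k : ℕ) {h r : ℕ} {Λ : Finset ℕ} {V : Type u} (G : RootedGraph h Λ V)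
    (v : Fin r → Option V) : Set (Atom k h Λ r) :=
  {a | a.Holds G v}

/-- The possible values of `sig^i(G, R, v)` for tuples `v` of length `m`. -/
def SigVal (k h : ℕ) (Λ : Finset ℕ) : ℕ → ℕ → Type
  | 0, m => Set (Atom k h Λ m)
  | i + 1, m => Set (SigVal k h Λ i (m + 1))

/-- `sig^i(G, R, v)` for a tuple `v` of length `m`; here `m + i` is the total depth `r`. -/
def sigAt (k : ℕ) {h : ℕ} {Λ : Finset ℕ} {V : Type u} (G : RootedGraph h Λ V) (R : Set V) :
    (i m : ℕ) → (Fin m → Option V) → SigVal k h Λ i m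
  | 0, _, v => pattern k G v
  | i + 1, m, v => {s : SigVal k h Λ i (m + 1) | ∃ w : Option V, (w = none ∨ ∃ x ∈ R, w = some x) ∧
      s = sigAt k G R i (m + 1) (Fin.snoc v w)}

/-- `sig^r(G, R)`. -/
def sig (k r : ℕ) {h : ℕ} {Λ : Finset ℕ} {V : Type u} (G : RootedGraph h Λ V) (R : Set V) :
    SigVal k h Λ r 0 :=
  sigAt k G R r 0 Fin.elim0

/-! ### First-order vocabulary -/

/-- One binary symbol for the edge relation and unary symbols indexed by `ι`. -/
inductive GraphRel (ι : Type) : ℕ → Type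
  | edge : GraphRel ι 2
  | unary (i : ι) : GraphRel ι 1

/-- The finite relational vocabulary of graphs with unary predicates indexed by `ι`. -/
def graphLang (ι : Type) : FirstOrder.Language where
  Functions := fun _ => Empty
  Relations := GraphRel ι

/-- A graph with unary predicates as a first-order structure. -/
abbrev graphStructure {ι : Type} {V : Type u} (A : SimpleGraph V) (U : ι → Set V) :
    (graphLang ι).Structure V where
  funMap := fun f _ => nomatch f
  RelMap := fun {_} R =>
    match R with
    | .edge => fun x => A.Adj (x 0) (x 1)
    | .unary i => fun x => x 0 ∈ U i

/-- The unary predicates of a rooted coloured graph: its colours, and for each label the predicate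
that holds exactly of the root with that label. -/
def RootedGraph.unary {h : ℕ} {Λ : Finset ℕ} {V : Type u} (G : RootedGraph h Λ V) :
    Fin h ⊕ Λ → Set V
  | .inl i => G.color i
  | .inr c => {G.root c}

/-- The unary predicates of `(G, R)`: those of `G`, and one for `R`. -/
def RootedGraph.unaryWith {h : ℕ} {Λ : Finset ℕ} {V : Type u} (G : RootedGraph h Λ V)
    (R : Set V) : Option (Fin h ⊕ Λ) → Set V
  | none => R
  | some i => G.unary i

/-- `G ⊨ φ(v)`, where `φ` is first-order (no disjoint-paths predicates). -/
def ModelsFO {h r : ℕ} {Λ : Finset ℕ} {V : Type u} (G : RootedGraph h Λ V)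
    (φ : (graphLang (Fin h ⊕ Λ)).Formula (Fin r)) (v : Fin r → V) : Prop :=
  letI := graphStructure G.graph G.unary
  φ.Realize v

/-- `(G, R) ⊨ φ`, where `φ` is a first-order sentence. -/
def ModelsFOWith {h : ℕ} {Λ : Finset ℕ} {V : Type u} (G : RootedGraph h Λ V) (R : Set V)
    (φ : (graphLang (Option (Fin h ⊕ Λ))).Sentence) : Prop :=
  letI := graphStructure G.graph (G.unaryWith R)
  FirstOrder.Language.Sentence.Realize V φ

end DPLogic

/-! Everything reduces to one fact: in an unbreakable graph with a large clique minor, `DP_j` is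
equivalent to a condition on boundedly many vertices (`Criterion`, proved in `dp_iff_criterion`).

A terminal is never an internal vertex of a path of a solution, so a `DP` instance becomes a
question about fully disjoint connected sets once each pair gets private copies of its terminals
(`linkGraph`, `dp_iff_linkable`). Among all parts of this graph that consist of the copies and at
most `L` other vertices, take one with fewest boundary vertices. The part consisting of the copies
alone shows that the minimum is at most `2 * j`.

If a smaller separation cut this part off from a branch set of the clique minor, then adding the
terminals to both of its sides would give a separation of the original graph of order at most `p`.
Its far side meets every branch set and so exceeds `L`; by unbreakability the near side has at most
`L` vertices, and it is a part with a smaller boundary, a contradiction. The Robertson–Seymour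
theorem `exists_rootedClique`, which rests on `menger`, on contraction and on Hall's theorem, then
gives a clique minor outside the part that is rooted at the boundary
(`exists_rootedClique_of_least`). Hence the outside can realise whatever connections between
boundary vertices a linkage asks for, and may be replaced by a clique on the boundary: the instance
is solvable if and only if it is solvable in the torso of the part (`linkable_localTorso`).

The part has bounded size, so its choice, the minimality and the solvability of its torso are
first-order. Patterns are finite Boolean combinations of atoms, and signatures are built from them
by finitely many quantifications over `R`; both have finitely many possible values. -/

namespace DPLogic

/-! ### Connected sets and separations -/

/-- `S` is nonempty and connected in `G`: every cut of `S` is crossed by an edge of `G`. -/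
def Linked {V : Type*} (G : SimpleGraph V) (S : Set V) : Prop :=
  S.Nonempty ∧ ∀ T : Set V, (∃ x ∈ S, x ∈ T) → (∃ x ∈ S, x ∉ T) →
    ∃ a ∈ S, ∃ b ∈ S, a ∈ T ∧ b ∉ T ∧ G.Adj a b

/-- `(A, B)` is a separation of `G`, given by its two vertex sets. -/
def Sep {V : Type*} (G : SimpleGraph V) (A B : Set V) : Prop :=
  (∀ x, x ∈ A ∨ x ∈ B) ∧ ∀ a b, a ∈ A → a ∉ B → b ∈ B → b ∉ A → ¬ G.Adj a b

section Linked

variable {V W : Type*} {G H : SimpleGraph V}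

theorem Sep.symm {A B : Set V} (h : Sep G A B) : Sep G B A :=
  ⟨fun x => (h.1 x).symm, fun a b ha ha' hb hb' hab => h.2 b a hb hb' ha ha' hab.symm⟩

theorem Linked.mono {S : Set V} (h : Linked G S) (hGH : ∀ a ∈ S, ∀ b ∈ S, G.Adj a b → H.Adj a b) :
    Linked H S :=
  ⟨h.1, fun T h1 h2 => by
    obtain ⟨a, ha, b, hb, h3, h4, h5⟩ := h.2 T h1 h2
    exact ⟨a, ha, b, hb, h3, h4, hGH a ha b hb h5⟩⟩

theorem linked_singleton (x : V) : Linked G {x} := by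
  refine ⟨⟨x, rfl⟩, ?_⟩
  rintro T ⟨y, rfl, hy⟩ ⟨z, rfl, hz⟩
  exact absurd hy hz

/-- The union of two connected sets, which share a vertex or are joined by an edge, is connected. -/
theorem Linked.union {S S' : Set V} (h : Linked G S) (h' : Linked G S')
    (hx : ∃ x ∈ S, ∃ y ∈ S', x = y ∨ G.Adj x y) : Linked G (S ∪ S') := by
  refine ⟨h.1.inl, fun T h1 h2 => ?_⟩
  obtain ⟨x, hx, y, hy, hxy⟩ := hx
  by_cases c : ∃ a ∈ S, ∃ b ∈ S, a ∈ T ∧ b ∉ T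
  · obtain ⟨a, ha, b, hb, haT, hbT⟩ := c
    obtain ⟨a, ha, b, hb, h3⟩ := h.2 T ⟨a, ha, haT⟩ ⟨b, hb, hbT⟩
    exact ⟨a, .inl ha, b, .inl hb, h3⟩
  by_cases c' : ∃ a ∈ S', ∃ b ∈ S', a ∈ T ∧ b ∉ T
  · obtain ⟨a, ha, b, hb, haT, hbT⟩ := c'
    obtain ⟨a, ha, b, hb, h3⟩ := h'.2 T ⟨a, ha, haT⟩ ⟨b, hb, hbT⟩
    exact ⟨a, .inr ha, b, .inr hb, h3⟩
  -- Neither set is split by `T`, so `T` contains one of them and misses the other, and the pair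
  -- `x`, `y` crosses the cut.
  push Not at c c'
  obtain ⟨p, hp, hpT⟩ := h1
  obtain ⟨r, hr, hrT⟩ := h2
  have key : (x ∈ T ∧ y ∉ T) ∨ (y ∈ T ∧ x ∉ T) := by
    rcases hp with hp | hp <;> rcases hr with hr | hr
    · exact absurd (c p hp r hr hpT) hrT
    · exact .inl ⟨c p hp x hx hpT, fun h => hrT (c' y hy r hr h)⟩
    · exact .inr ⟨c' p hp y hy hpT, fun h => hrT (c x hx r hr h)⟩
    · exact absurd (c' p hp r hr hpT) hrT
  rcases key with ⟨h1, h2⟩ | ⟨h1, h2⟩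
  · rcases hxy with rfl | hxy
    · exact absurd h1 h2
    · exact ⟨x, .inl hx, y, .inr hy, h1, h2, hxy⟩
  · rcases hxy with rfl | hxy
    · exact absurd h1 h2
    · exact ⟨y, .inr hy, x, .inl hx, h1, h2, hxy.symm⟩

/-- A connected set cannot leave a set that contains all edges. -/
theorem Linked.subset_of_mem {S B : Set V} (h : Linked G S) (hB : ∀ a b, G.Adj a b → b ∈ B)
    {x : V} (hx : x ∈ S) (hxB : x ∈ B) : S ⊆ B := by
  intro y hy
  by_contra hyB
  obtain ⟨a, _, b, _, _, h2, h3⟩ := h.2 B ⟨x, hx, hxB⟩ ⟨y, hy, hyB⟩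
  exact h2 (hB a b h3)

/-- Otherwise the cut of `S` along `A` would be crossed by an edge from `A \ B` to `B \ A`. -/
theorem Linked.meets_inter {S A B : Set V} (h : Linked G S) (hs : Sep G A B)
    (hA : ∃ x ∈ S, x ∈ A) (hB : ∃ x ∈ S, x ∈ B) : ∃ x ∈ S, x ∈ A ∧ x ∈ B := by
  by_contra hc
  push Not at hc
  obtain ⟨x, hx, hxA⟩ := hA
  obtain ⟨y, hy, hyB⟩ := hB
  obtain ⟨a, ha, b, hb, h1, h2, h3⟩ := h.2 A ⟨x, hx, hxA⟩ ⟨y, hy, fun h => hc y hy h hyB⟩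
  exact hs.2 a b h1 (hc a ha h1) ((hs.1 b).resolve_left h2) h2 h3

theorem exists_walk_of_linked {H : SimpleGraph W} {S : Set W} (h : Linked H S) (π : W → V)
    (hπ : ∀ a ∈ S, ∀ b ∈ S, H.Adj a b → G.Adj (π a) (π b)) {a b : W} (ha : a ∈ S) (hb : b ∈ S) :
    ∃ w : G.Walk (π a) (π b), ∀ x ∈ w.support, x ∈ π '' S := by
  by_contra hc
  -- The cut tested is the set of vertices whose image is reachable from `π a` within the image of
  -- `S`.
  obtain ⟨c, hc, d, hd, ⟨w, hw⟩, h2, h3⟩ := h.2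
    {c | ∃ w : G.Walk (π a) (π c), ∀ x ∈ w.support, x ∈ π '' S}
    ⟨a, ha, .nil, by simpa using ⟨a, ha, rfl⟩⟩ ⟨b, hb, hc⟩
  refine h2 ⟨w.concat (hπ c hc d hd h3), fun x hx => ?_⟩
  rw [SimpleGraph.Walk.support_concat] at hx
  rcases List.mem_append.1 hx with hx | hx
  · exact hw x hx
  · rw [List.mem_singleton.1 hx]; exact ⟨d, hd, rfl⟩

theorem linked_of_connected {S : Set V} (h : (G.induce S).Connected) : Linked G S := by
  obtain ⟨⟨x, hx⟩⟩ := h.nonempty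
  refine ⟨⟨x, hx⟩, ?_⟩
  rintro T ⟨a, ha, haT⟩ ⟨b, hb, hbT⟩
  obtain ⟨w⟩ := h.preconnected ⟨a, ha⟩ ⟨b, hb⟩
  obtain ⟨d, -, h1, h2⟩ := w.exists_boundary_dart {x | x.1 ∈ T} haT hbT
  exact ⟨d.fst, d.fst.2, d.snd, d.snd.2, h1, h2, d.adj⟩

theorem linked_image {H : SimpleGraph W} {S : Set V} (h : Linked G S) (f : V → W)
    (hf : ∀ a ∈ S, ∀ b ∈ S, G.Adj a b → f a ≠ f b → H.Adj (f a) (f b)) : Linked H (f '' S) := by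
  refine ⟨h.1.image f, ?_⟩
  rintro T ⟨_, ⟨x, hx, rfl⟩, hxT⟩ ⟨_, ⟨y, hy, rfl⟩, hyT⟩
  obtain ⟨a, ha, b, hb, h1, h2, h3⟩ := h.2 (f ⁻¹' T) ⟨x, hx, hxT⟩ ⟨y, hy, hyT⟩
  exact ⟨f a, ⟨a, ha, rfl⟩, f b, ⟨b, hb, rfl⟩, h1, h2,
    hf a ha b hb h3 fun e => h2 (by simpa [e] using h1)⟩

end Linked

/-! ### Menger's theorem -/

/-- Pairwise disjoint sets meeting `T`, as many as `T` has elements, meet `T` in one vertex each. -/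
theorem exists_transversal {V : Type*} [Finite V] {T : Set V} {k : ℕ} (hT : T.ncard ≤ k)
    {P : Fin k → Set V} (hP : ∀ i, ∃ x ∈ P i, x ∈ T)
    (hd : ∀ i j, i ≠ j → Disjoint (P i) (P j)) :
    ∃ p : Fin k → V, (∀ i, p i ∈ P i) ∧ (∀ i, p i ∈ T) ∧ (∀ y ∈ T, ∃ i, p i = y) ∧
      (∀ i, ∀ y ∈ P i, y ∈ T → y = p i) := by
  choose p hp hpT using hP
  have inj : Function.Injective p := fun i j hij => by
    by_contra hne
    exact Set.disjoint_left.1 (hd i j hne) (hp i) (hij ▸ hp j)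
  have hr : Set.range p = T := by
    refine Set.eq_of_subset_of_ncard_le (by rintro _ ⟨i, rfl⟩; exact hpT i) ?_ (Set.toFinite _)
    rw [← Set.image_univ, Set.ncard_image_of_injective _ inj, Set.ncard_univ, Nat.card_fin]
    exact hT
  have hs : ∀ y ∈ T, ∃ i, p i = y := fun y hy => by rw [← hr] at hy; exact hy
  refine ⟨p, hp, hpT, hs, fun i y hy hyT => ?_⟩
  obtain ⟨j, rfl⟩ := hs y hyT
  by_cases hij : i = j
  · rw [hij]
  · exact absurd (hp j) (Set.disjoint_left.1 (hd i j hij) hy)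

/-- The edges of `G` inside `A`. -/
def within {V : Type*} (G : SimpleGraph V) (A : Set V) : SimpleGraph V where
  Adj a b := G.Adj a b ∧ a ∈ A ∧ b ∈ A
  symm := ⟨fun _ _ h => ⟨h.1.symm, h.2.2, h.2.1⟩⟩
  loopless := ⟨fun _ h => h.1.ne rfl⟩

/-- A separation of the side `A` extends to the whole graph by adding `B` to its second side. In
`menger`, `G₀` is `G` without one edge, and `hG` says that this edge does not spoil the result;
elsewhere the two graphs coincide. -/
theorem Sep.combine_within {V : Type*} {G G₀ : SimpleGraph V} {A B A₁ B₁ : Set V} (h : Sep G₀ A B)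
    (hG : ∀ a b, G.Adj a b → a ∈ A → a ∉ B₁ → G₀.Adj a b)
    (h₁ : Sep (within G₀ A) A₁ B₁) : Sep G (A ∩ A₁) (B ∪ B₁) := by
  constructor
  · intro x
    have := h.1 x; have := h₁.1 x
    simp only [Set.mem_inter_iff, Set.mem_union]; tauto
  · rintro a b ⟨ha, ha1⟩ ha2 hb hb2 hab
    simp only [Set.mem_inter_iff, Set.mem_union, not_or, not_and] at ha2 hb hb2
    have hab := hG a b hab ha ha2.2
    by_cases hbA : b ∈ A
    · exact h₁.2 a b ha1 ha2.2 ((h₁.1 b).resolve_left (hb2 hbA)) (hb2 hbA) ⟨hab, ha, hbA⟩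
    · exact h.2 a b ha ha2.1 ((h.1 b).resolve_left hbA) hbA hab

/-- **Menger's theorem**, with connected sets instead of paths. -/
theorem menger {V : Type*} [Finite V] (k : ℕ) (G : SimpleGraph V) : ∀ (X Y : Set V),
    (∀ A B, Sep G A B → X ⊆ A → Y ⊆ B → k ≤ (A ∩ B).ncard) →
    ∃ P : Fin k → Set V, (∀ i, Linked G (P i) ∧ (∃ x ∈ P i, x ∈ X) ∧ (∃ x ∈ P i, x ∈ Y)) ∧
      ∀ i j, i ≠ j → Disjoint (P i) (P j) := by
  induction G using WellFoundedLT.induction with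
  | _ G ih =>
  intro X Y hsep
  -- Without edges, the separation `(X, Xᶜ ∪ Y)` shows that `X ∩ Y` has `k` elements, and singletons
  -- suffice.
  by_cases he : ∀ u v, ¬ G.Adj u v
  · have h := hsep X (Xᶜ ∪ Y) ⟨fun x => by by_cases x ∈ X <;> simp [*], fun a b _ _ _ _ => he a b⟩
      subset_rfl Set.subset_union_right
    have hXY : X ∩ (Xᶜ ∪ Y) = X ∩ Y := by ext; simp; tauto
    rw [hXY] at h
    obtain ⟨T, hT, hk⟩ := Set.exists_subset_card_eq h
    have e : T ≃ Fin k := Finite.equivFinOfCardEq hk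
    refine ⟨fun i => {(e.symm i).1}, fun i => ⟨linked_singleton _, ⟨_, rfl, (hT (e.symm i).2).1⟩,
      ⟨_, rfl, (hT (e.symm i).2).2⟩⟩, fun i j hij => ?_⟩
    simpa [Subtype.val_inj] using hij
  push Not at he
  obtain ⟨u, v, huv⟩ := he
  let G₀ : SimpleGraph V := G.deleteEdges {s(u, v)}
  have hG₀ : ∀ a b, G₀.Adj a b ↔ G.Adj a b ∧ s(a, b) ≠ s(u, v) := by
    intro a b; simp [G₀, SimpleGraph.deleteEdges_adj]
  have hlt : G₀ < G := by
    refine lt_of_le_of_ne (SimpleGraph.deleteEdges_le _) fun e => ?_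
    exact ((hG₀ u v).1 (e ▸ huv)).2 rfl
  by_cases hG : ∀ A B, Sep G₀ A B → X ⊆ A → Y ⊆ B → k ≤ (A ∩ B).ncard
  · obtain ⟨P, hP, hd⟩ := ih G₀ hlt X Y hG
    exact ⟨P, fun i => ⟨(hP i).1.mono fun a _ b _ h => ((hG₀ a b).1 h).1, (hP i).2⟩, hd⟩
  push Not at hG
  obtain ⟨A, B, hAB, hXA, hYB, hlt'⟩ := hG
  -- Deleting the edge created a separation of order less than `k`, so the deleted edge must cross
  -- it; name its ends so that `u` lies in `A` and `v` in `B`.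
  have hnot : ¬ Sep G A B := fun h => absurd (hsep A B h hXA hYB) (by omega)
  obtain ⟨u, v, huA, huB, hvB, hvA, huv, hG₀⟩ : ∃ u v, u ∈ A ∧ u ∉ B ∧ v ∈ B ∧ v ∉ A ∧ G.Adj u v ∧
      ∀ a b, G₀.Adj a b ↔ G.Adj a b ∧ s(a, b) ≠ s(u, v) := by
    by_contra hc
    refine hnot ⟨hAB.1, fun a b ha ha' hb hb' hab => ?_⟩
    by_cases hs : s(a, b) = s(u, v)
    · exact hc ⟨a, b, ha, ha', hb, hb', hab, fun c d => by rw [hG₀, hs]⟩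
    · exact hAB.2 a b ha ha' hb hb' ((hG₀ a b).2 ⟨hab, hs⟩)
  have hne : ∀ a b, G.Adj a b → (a ≠ u ∧ a ≠ v) → G₀.Adj a b := fun a b hab hn => by
    rw [hG₀]; refine ⟨hab, fun hs => ?_⟩
    rcases Sym2.eq_iff.1 hs with h | h
    · exact hn.1 h.1
    · exact hn.2 h.1
  -- Adding `u` to `A ∩ B` makes it separate `X` from `Y` in `G`. A smaller separator of `X` from it
  -- inside `A` would therefore separate `X` from `Y`. The side `B` is symmetric, with `v`.
  obtain ⟨P, hP, hPd⟩ := ih (within G₀ A) (lt_of_le_of_lt (fun a b h => h.1) hlt) X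
    (insert u (A ∩ B)) fun A₁ B₁ h₁ hX₁ hY₁ => by
      have h := hsep (A ∩ A₁) (B ∪ B₁) (hAB.combine_within (fun a b hab ha ha' => hne a b hab
        ⟨fun e => ha' (hY₁ (.inl e)), fun e => hvA (e ▸ ha)⟩) h₁) (Set.subset_inter hXA hX₁)
        (hYB.trans Set.subset_union_left)
      refine h.trans (Set.ncard_le_ncard ?_ (Set.toFinite _))
      rintro x ⟨⟨hx1, hx2⟩, hx3 | hx3⟩
      · exact ⟨hx2, hY₁ (.inr ⟨hx1, hx3⟩)⟩
      · exact ⟨hx2, hx3⟩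
  obtain ⟨Q, hQ, hQd⟩ := ih (within G₀ B) (lt_of_le_of_lt (fun a b h => h.1) hlt)
    (insert v (A ∩ B)) Y fun A₁ B₁ h₁ hX₁ hY₁ => by
      have h := hsep (A ∪ A₁) (B ∩ B₁) (hAB.symm.combine_within (fun a b hab ha ha' => hne a b hab
        ⟨fun e => huB (e ▸ ha), fun e => ha' (hX₁ (.inl e))⟩) h₁.symm).symm
        (hXA.trans Set.subset_union_left) (Set.subset_inter hYB hY₁)
      refine h.trans (Set.ncard_le_ncard ?_ (Set.toFinite _))
      rintro x ⟨hx3 | hx3, hx1, hx2⟩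
      · exact ⟨hX₁ (.inr ⟨hx3, hx1⟩), hx2⟩
      · exact ⟨hx3, hx2⟩
  have hPA : ∀ i, P i ⊆ A := fun i => by
    obtain ⟨x, hx, hxX⟩ := (hP i).2.1
    exact (hP i).1.subset_of_mem (fun a b h => h.2.2) hx (hXA hxX)
  have hQB : ∀ i, Q i ⊆ B := fun i => by
    obtain ⟨x, hx, hxY⟩ := (hQ i).2.2
    exact (hQ i).1.subset_of_mem (fun a b h => h.2.2) hx (hYB hxY)
  obtain ⟨p, hpP, hpT, hps, hpu⟩ := exists_transversal ((Set.ncard_insert_le _ _).trans hlt')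
    (fun i => (hP i).2.2) hPd
  obtain ⟨q, hqQ, hqT, hqs, hqu⟩ := exists_transversal ((Set.ncard_insert_le _ _).trans hlt')
    (fun i => (hQ i).2.1) hQd
  -- Each target set has at most `k` elements, so the `k` disjoint sets use all of it. Those ending
  -- at the same vertex of `A ∩ B` are glued there; the one ending at `u` and the one starting at
  -- `v` are joined by the edge `uv`.
  have hσ : ∀ i, ∃ j, (p i ∈ A ∩ B ∧ q j = p i) ∨ (p i = u ∧ q j = v) := fun i => by
    rcases hpT i with h | h
    · obtain ⟨j, hj⟩ := hqs v (.inl rfl)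
      exact ⟨j, .inr ⟨h, hj⟩⟩
    · obtain ⟨j, hj⟩ := hqs (p i) (.inr h)
      exact ⟨j, .inl ⟨h, hj⟩⟩
  choose σ hσ using hσ
  have hpinj : Function.Injective p := fun i j hij => by
    by_contra hne
    exact Set.disjoint_left.1 (hPd i j hne) (hpP i) (hij ▸ hpP j)
  have hσinj : ∀ i j, σ i = σ j → i = j := fun i j hij => by
    refine hpinj ?_
    have h1 := hσ i
    have h2 := hσ j
    rw [← hij] at h2
    rcases h1 with ⟨h1, h1'⟩ | ⟨h1, h1'⟩ <;> rcases h2 with ⟨h2, h2'⟩ | ⟨h2, h2'⟩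
    · rw [← h1', ← h2']
    · rw [← h1', h2'] at h1; exact absurd h1.1 hvA
    · rw [← h2', h1'] at h2; exact absurd h2.1 hvA
    · rw [h1, h2]
  have hmono : ∀ {D : Set V} {S : Set V}, Linked (within G₀ D) S → Linked G S := fun h =>
    h.mono fun a _ b _ hab => ((hG₀ a b).1 hab.1).1
  have hPQ : ∀ i j, ∀ x ∈ P i, x ∈ Q (σ j) → i = j := fun i j x hx hx' => by
    have hxS : x ∈ A ∩ B := ⟨hPA i hx, hQB _ hx'⟩
    have h1 := hpu i x hx (.inr hxS)
    have h2 := hqu _ x hx' (.inr hxS)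
    rcases hσ j with ⟨h3, h4⟩ | ⟨h3, h4⟩
    · exact hpinj (by rw [← h1, h2, h4])
    · rw [h2, h4] at hxS; exact absurd hxS.1 hvA
  refine ⟨fun i => P i ∪ Q (σ i), fun i => ⟨(hmono (hP i).1).union (hmono (hQ (σ i)).1) ?_, ?_, ?_⟩,
    fun i j hij => ?_⟩
  · refine ⟨p i, hpP i, q (σ i), hqQ _, ?_⟩
    rcases hσ i with ⟨h3, h4⟩ | ⟨h3, h4⟩
    · exact .inl h4.symm
    · rw [h3, h4]; exact .inr huv
  · obtain ⟨x, hx, hxX⟩ := (hP i).2.1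
    exact ⟨x, .inl hx, hxX⟩
  · obtain ⟨x, hx, hxX⟩ := (hQ (σ i)).2.2
    exact ⟨x, .inr hx, hxX⟩
  · rw [Set.disjoint_left]
    rintro x (hx | hx) (hx' | hx')
    · exact Set.disjoint_left.1 (hPd i j hij) hx hx'
    · exact hij (hPQ i j x hx hx')
    · exact hij (hPQ j i x hx' hx).symm
    · exact Set.disjoint_left.1 (hQd _ _ fun e => hij (hσinj i j e)) hx hx'

/-! ### Rooted clique minors -/

/-- The graph of the edges of `G` inside `B`, with a clique added on `X`. -/
def torso {V : Type*} (G : SimpleGraph V) (B X : Set V) : SimpleGraph V where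
  Adj a b := (G.Adj a b ∧ a ∈ B ∧ b ∈ B) ∨ (a ≠ b ∧ a ∈ X ∧ b ∈ X)
  symm := ⟨fun _ _ h => h.imp (fun h => ⟨h.1.symm, h.2.2, h.2.1⟩) fun h => ⟨h.1.symm, h.2.2, h.2.1⟩⟩
  loopless := ⟨fun _ h => h.elim (fun h => h.1.ne rfl) fun h => h.1 rfl⟩

/-- The sets `C i` are the branch sets of a clique minor of `G`. -/
structure CliqueModel {V κ : Type*} (G : SimpleGraph V) (C : κ → Set V) : Prop where
  linked : ∀ i, Linked G (C i)
  disj : ∀ i j, i ≠ j → Disjoint (C i) (C j)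
  touch : ∀ i j, i ≠ j → ∃ a ∈ C i, ∃ b ∈ C j, G.Adj a b

/-- No separation of order less than `n` separates `X` from a branch set. -/
def Attached {V κ : Type*} (G : SimpleGraph V) (X : Set V) (C : κ → Set V) (n : ℕ) : Prop :=
  ∀ A B, Sep G A B → X ⊆ A → (∃ i, Disjoint (C i) A) → n ≤ (A ∩ B).ncard

/-- The sets `D x` are the branch sets of a clique minor rooted at `X`, with edges between branch
sets other than those inside `X`. -/
structure RootedClique {V : Type*} (G : SimpleGraph V) (X : Set V) (D : V → Set V) : Prop where
  mem : ∀ x ∈ X, x ∈ D x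
  linked : ∀ x ∈ X, Linked G (D x)
  disj : ∀ x ∈ X, ∀ y ∈ X, x ≠ y → Disjoint (D x) (D y)
  touch : ∀ x ∈ X, ∀ y ∈ X, x ≠ y → ∃ a ∈ D x, ∃ b ∈ D y, G.Adj a b ∧ ¬ (a ∈ X ∧ b ∈ X)

section Torso

variable {V κ : Type*} {G : SimpleGraph V} {A B : Set V}

/-- A stretch of `S` outside `B` enters and leaves through `A ∩ B`, where the added clique replaces
it. If `T` splits `S ∩ A ∩ B`, a clique edge crosses; otherwise an edge of `G` crossing a suitable
cut already lies in `B`. -/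
theorem Linked.torso {S : Set V} (h : Linked G S) (hs : Sep G A B) (hSB : ∃ x ∈ S, x ∈ B) :
    Linked (torso G B (A ∩ B)) (S ∩ B) := by
  obtain ⟨x, hx, hxB⟩ := hSB
  refine ⟨⟨x, hx, hxB⟩, ?_⟩
  rintro T ⟨y, ⟨hy, hyB⟩, hyT⟩ ⟨z, ⟨hz, hzB⟩, hzT⟩
  by_cases c1 : ∃ a ∈ S, a ∈ T ∧ a ∈ A ∧ a ∈ B
  · by_cases c2 : ∃ b ∈ S, b ∉ T ∧ b ∈ A ∧ b ∈ B
    · obtain ⟨a, ha, haT, haA, haB⟩ := c1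
      obtain ⟨b, hb, hbT, hbA, hbB⟩ := c2
      exact ⟨a, ⟨ha, haB⟩, b, ⟨hb, hbB⟩, haT, hbT,
        .inr ⟨fun e => hbT (e ▸ haT), ⟨haA, haB⟩, ⟨hbA, hbB⟩⟩⟩
    · push Not at c2
      obtain ⟨b, hb, a, ha, h1, h2, h3⟩ := h.2 (B \ T) ⟨z, hz, hzB, hzT⟩
        ⟨y, hy, fun h => h.2 hyT⟩
      have hbA : b ∉ A := fun hA => c2 b hb h1.2 hA h1.1
      have haB : a ∈ B := by
        by_contra haB
        exact hs.2 a b ((hs.1 a).resolve_right haB) haB h1.1 hbA h3.symm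
      have haT : a ∈ T := by by_contra haT; exact h2 ⟨haB, haT⟩
      exact ⟨a, ⟨ha, haB⟩, b, ⟨hb, h1.1⟩, haT, h1.2, .inl ⟨h3.symm, haB, h1.1⟩⟩
  · push Not at c1
    obtain ⟨a, ha, b, hb, h1, h2, h3⟩ := h.2 (B ∩ T) ⟨y, hy, hyB, hyT⟩ ⟨z, hz, fun h => hzT h.2⟩
    have haA : a ∉ A := fun hA => c1 a ha h1.2 hA h1.1
    have hbB : b ∈ B := by
      by_contra hbB
      exact hs.2 b a ((hs.1 b).resolve_right hbB) hbB h1.1 haA h3.symm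
    exact ⟨a, ⟨ha, h1.1⟩, b, ⟨hb, hbB⟩, h1.2, fun hbT => h2 ⟨hbB, hbT⟩, .inl ⟨h3, h1.1, hbB⟩⟩

/-- One branch set lies in `B \ A`, so all others, being adjacent to it, meet `B`. If the edge
between two branch sets is not in `B`, both meet `A ∩ B` and a clique edge joins them. -/
theorem CliqueModel.torso {C : κ → Set V} (hC : CliqueModel G C) (hs : Sep G A B) {i₀ : κ}
    (hi₀ : Disjoint (C i₀) A) : CliqueModel (torso G B (A ∩ B)) (fun i => C i ∩ B) := by
  have hB₀ : ∀ x ∈ C i₀, x ∈ B := fun x hx => (hs.1 x).resolve_left (Set.disjoint_left.1 hi₀ hx)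
  have hB : ∀ i, ∃ x ∈ C i, x ∈ B := fun i => by
    by_cases h : i = i₀
    · obtain ⟨x, hx⟩ := (hC.linked i₀).1
      exact ⟨x, h ▸ hx, hB₀ x hx⟩
    · obtain ⟨a, ha, b, hb, hab⟩ := hC.touch i i₀ h
      refine ⟨a, ha, ?_⟩
      by_contra haB
      exact hs.2 a b ((hs.1 a).resolve_right haB) haB (hB₀ b hb) (Set.disjoint_left.1 hi₀ hb) hab
  refine ⟨fun i => (hC.linked i).torso hs (hB i), fun i j hij =>
    (hC.disj i j hij).mono Set.inter_subset_left Set.inter_subset_left, fun i j hij => ?_⟩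
  obtain ⟨a, ha, b, hb, hab⟩ := hC.touch i j hij
  by_cases h : a ∈ B ∧ b ∈ B
  · exact ⟨a, ⟨ha, h.1⟩, b, ⟨hb, h.2⟩, .inl ⟨hab, h.1, h.2⟩⟩
  have hA : a ∈ A ∧ b ∈ A := by
    have h1 := hs.1 a
    have h2 := hs.1 b
    have h3 := hs.2 a b
    have h4 := fun x y z w => hs.2 b a x y z w hab.symm
    tauto
  obtain ⟨x, hx, hxA, hxB⟩ := (hC.linked i).meets_inter hs ⟨a, ha, hA.1⟩ (hB i)
  obtain ⟨y, hy, hyA, hyB⟩ := (hC.linked j).meets_inter hs ⟨b, hb, hA.2⟩ (hB j)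
  exact ⟨x, ⟨hx, hxB⟩, y, ⟨hy, hyB⟩, .inr ⟨fun e =>
    Set.disjoint_left.1 (hC.disj i j hij) hx (e ▸ hy), ⟨hxA, hxB⟩, ⟨hyA, hyB⟩⟩⟩

/-- A separation `(A₁, B₁)` of the torso whose first side contains `A ∩ B` lifts to `(A ∪ A₁, B ∩
B₁)`, without increase of order. -/
theorem Attached.torso [Finite V] {C : κ → Set V} (hC : CliqueModel G C) (hs : Sep G A B) {i₀ : κ}
    (hi₀ : Disjoint (C i₀) A) {n : ℕ} (h : Attached G A C n) :
    Attached (torso G B (A ∩ B)) (A ∩ B) (fun i => C i ∩ B) n := by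
  rintro A₁ B₁ h₁ hX ⟨i, hi⟩
  have hCB := ((hC.torso hs hi₀).linked i).1
  have hiA : Disjoint (C i) A := by
    rw [Set.disjoint_left]
    intro x hx hxA
    obtain ⟨y, hy, hyB⟩ := hCB
    obtain ⟨z, hz, hzA, hzB⟩ := (hC.linked i).meets_inter hs ⟨x, hx, hxA⟩ ⟨y, hy, hyB⟩
    exact Set.disjoint_left.1 hi ⟨hz, hzB⟩ (hX ⟨hzA, hzB⟩)
  refine (h (A ∪ A₁) (B ∩ B₁) ⟨fun x => ?_, ?_⟩ Set.subset_union_left ⟨i, ?_⟩).trans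
    (Set.ncard_le_ncard ?_ (Set.toFinite _))
  · have := hs.1 x; have := h₁.1 x
    simp only [Set.mem_inter_iff, Set.mem_union]; tauto
  · rintro a b - ha ⟨hbB, hbB₁⟩ hb hab
    simp only [Set.mem_union, not_or] at hb
    have haB : a ∈ B := by
      by_contra haB
      exact hs.2 a b ((hs.1 a).resolve_right haB) haB hbB hb.1 hab
    have haB₁ : a ∉ B₁ := fun h => ha ⟨haB, h⟩
    exact h₁.2 a b ((h₁.1 a).resolve_right haB₁) haB₁ hbB₁ hb.2 (.inl ⟨hab, haB, hbB⟩)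
  · rw [Set.disjoint_union_right]
    refine ⟨hiA, Set.disjoint_left.2 fun x hx hx₁ => Set.disjoint_left.1 hi ⟨hx, ?_⟩ hx₁⟩
    exact (hs.1 x).resolve_left (Set.disjoint_left.1 hiA hx)
  · rintro x ⟨hx | hx, hxB, hxB₁⟩
    · exact ⟨hX ⟨hx, hxB⟩, hxB₁⟩
    · exact ⟨hx, hxB₁⟩

/-- The added edges are never needed: each branch set contains only one vertex of `X`, and the edges
between branch sets are required not to lie inside `X`. -/
theorem RootedClique.of_torso {X : Set V} (hXB : X ⊆ B) {D : V → Set V}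
    (h : RootedClique (torso G B X) X D) :
    RootedClique G X D ∧ ∀ x ∈ X, D x ⊆ B := by
  have huniq : ∀ x ∈ X, ∀ y ∈ X, y ∈ D x → y = x := fun x hx y hy hyx => by
    by_contra hne
    exact Set.disjoint_left.1 (h.disj y hy x hx hne) (h.mem y hy) hyx
  refine ⟨⟨h.mem, fun x hx => (h.linked x hx).mono fun a ha b hb hab => ?_, h.disj,
    fun x hx y hy hxy => ?_⟩, fun x hx => (h.linked x hx).subset_of_mem ?_ (h.mem x hx) (hXB hx)⟩
  · rcases hab with hab | hab
    · exact hab.1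
    · exact absurd ((huniq x hx a hab.2.1 ha).trans (huniq x hx b hab.2.2 hb).symm) hab.1
  · obtain ⟨a, ha, b, hb, hab, hX⟩ := h.touch x hx y hy hxy
    refine ⟨a, ha, b, hb, ?_, hX⟩
    rcases hab with hab | hab
    · exact hab.1
    · exact absurd hab.2 hX
  · rintro a b (hab | hab)
    · exact hab.2.2
    · exact hXB hab.2.2

end Torso

/-- The graph on the vertices of `G` obtained by identifying vertices along `f`. -/
def identify {V : Type*} (G : SimpleGraph V) (f : V → V) : SimpleGraph V where
  Adj a b := a ≠ b ∧ ∃ a' b', G.Adj a' b' ∧ f a' = a ∧ f b' = b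
  symm := ⟨fun _ _ ⟨h, a, b, h1, h2, h3⟩ => ⟨h.symm, b, a, h1.symm, h3, h2⟩⟩
  loopless := ⟨fun _ h => h.1 rfl⟩

section Rooted

variable {V : Type*} {κ : Type*} {G : SimpleGraph V} {X : Set V}

/-- Extending a rooted clique minor along disjoint connected sets from `X` to `A ∩ B`. -/
theorem rootedClique_of_sep [Finite V] {A B : Set V} {C : κ → Set V} (hatt : Attached G X C X.ncard)
    (hs : Sep G A B) (hXA : X ⊆ A) (hCA : ∃ i, Disjoint (C i) A) (hle : (A ∩ B).ncard ≤ X.ncard)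
    {D : V → Set V} (hD : RootedClique (torso G B (A ∩ B)) (A ∩ B) D) :
    ∃ D, RootedClique G X D := by
  obtain ⟨hD, hDB⟩ := hD.of_torso Set.inter_subset_right
  -- A small separator of `X` from `A ∩ B` inside `A` would, after adding `B` to its second side,
  -- separate `X` from the branch set that avoids `A`.
  obtain ⟨P, hP, hPd⟩ := menger X.ncard (within G A) X (A ∩ B) fun A₁ B₁ h₁ hX₁ hY₁ => by
    obtain ⟨i, hi⟩ := hCA
    refine (hatt (A ∩ A₁) (B ∪ B₁) (hs.combine_within (fun a b hab _ _ => hab) h₁)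
      (Set.subset_inter hXA hX₁) ⟨i, hi.mono_right Set.inter_subset_left⟩).trans
      (Set.ncard_le_ncard ?_ (Set.toFinite _))
    rintro x ⟨⟨hx1, hx2⟩, hx3 | hx3⟩
    · exact ⟨hx2, hY₁ ⟨hx1, hx3⟩⟩
    · exact ⟨hx2, hx3⟩
  have hPA : ∀ i, P i ⊆ A := fun i => by
    obtain ⟨x, hx, hxX⟩ := (hP i).2.1
    exact (hP i).1.subset_of_mem (fun a b h => h.2.2) hx (hXA hxX)
  obtain ⟨p, hpP, hpX, hps, hpu⟩ := exists_transversal le_rfl (fun i => (hP i).2.1) hPd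
  obtain ⟨q, hqP, hqT, hqs, hqu⟩ := exists_transversal hle (fun i => (hP i).2.2) hPd
  rcases X.eq_empty_or_nonempty with rfl | ⟨x₀, hx₀⟩
  · exact ⟨fun _ => ∅, by simp, by simp, by simp, by simp⟩
  have : Nonempty (Fin X.ncard) := ⟨(hps x₀ hx₀).choose⟩
  choose! σ hσ using hps
  have hσinj : ∀ x ∈ X, ∀ y ∈ X, x ≠ y → σ x ≠ σ y := fun x hx y hy hne e =>
    hne (by rw [← hσ x hx, ← hσ y hy, e])
  have hqne : ∀ i j, i ≠ j → q i ≠ q j := fun i j hij e =>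
    Set.disjoint_left.1 (hPd i j hij) (hqP i) (e ▸ hqP j)
  have hPD : ∀ i j, i ≠ j → Disjoint (P i) (D (q j)) := fun i j hij => by
    rw [Set.disjoint_left]
    intro x hx hx'
    have hxS : x ∈ A ∩ B := ⟨hPA i hx, hDB _ (hqT j) hx'⟩
    have h1 := hqu i x hx hxS
    subst h1
    exact Set.disjoint_left.1 (hD.disj _ (hqT i) _ (hqT j) (hqne i j hij)) (hD.mem _ (hqT i)) hx'
  refine ⟨fun x => P (σ x) ∪ D (q (σ x)), fun x hx => .inl ?_, fun x hx => ?_,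
    fun x hx y hy hxy => ?_, fun x hx y hy hxy => ?_⟩
  · have := hpP (σ x); rwa [hσ x hx] at this
  · exact ((hP _).1.mono fun a _ b _ h => h.1).union (hD.linked _ (hqT _))
      ⟨q (σ x), hqP _, q (σ x), hD.mem _ (hqT _), .inl rfl⟩
  · have hne := hσinj x hx y hy hxy
    rw [Set.disjoint_union_left, Set.disjoint_union_right, Set.disjoint_union_right]
    exact ⟨⟨hPd _ _ hne, hPD _ _ hne⟩, ⟨(hPD _ _ hne.symm).symm,
      hD.disj _ (hqT _) _ (hqT _) (hqne _ _ hne)⟩⟩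
  · obtain ⟨a, ha, b, hb, hab, hX⟩ := hD.touch _ (hqT _) _ (hqT _) (hqne _ _ (hσinj x hx y hy hxy))
    exact ⟨a, .inr ha, b, .inr hb, hab, fun h => hX ⟨⟨hXA h.1, hDB _ (hqT _) ha⟩,
      ⟨hXA h.2, hDB _ (hqT _) hb⟩⟩⟩

/-- The case in which all edges outside `X` join different branch sets. -/
theorem rootedClique_of_matching [Finite V] [Finite κ] {C : κ → Set V} (hC : CliqueModel G C)
    (hcard : 2 * X.ncard ≤ Nat.card κ) (hatt : Attached G X C X.ncard)
    (hedge : ∀ u v, G.Adj u v → ¬ (u ∈ X ∧ v ∈ X) → ∃ i j, u ∈ C i ∧ v ∈ C j ∧ i ≠ j) :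
    ∃ D, RootedClique G X D := by
  classical
  -- An edge leaving `v` inside `C i` would have both ends in one branch set and not lie inside `X`,
  -- against `hedge`. So every branch set with a vertex outside `X` is a singleton, and the
  -- neighbours of `X` outside `X` form a clique (`hadj`).
  have hsingle : ∀ i, ∀ v ∈ C i, v ∉ X → ∀ w ∈ C i, w = v := fun i v hv hvX w hw => by
    by_contra hne
    obtain ⟨a, ha, b, hb, h1, h2, h3⟩ := (hC.linked i).2 {v} ⟨v, hv, rfl⟩ ⟨w, hw, hne⟩
    obtain ⟨j, l, hj, hl, hjl⟩ := hedge a b h3 fun h => hvX (h1 ▸ h.1)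
    have e1 : i = j := by by_contra h; exact Set.disjoint_left.1 (hC.disj i j h) ha hj
    have e2 : i = l := by by_contra h; exact Set.disjoint_left.1 (hC.disj i l h) hb hl
    exact hjl (e1.symm.trans e2)
  have hadj : ∀ x y v w, v ∉ X → w ∉ X → v ≠ w → G.Adj x v → G.Adj y w → G.Adj v w := by
    intro x y v w hv hw hne hxv hyw
    obtain ⟨-, i, -, hi, -⟩ := hedge x v hxv fun h => hv h.2
    obtain ⟨-, j, -, hj, -⟩ := hedge y w hyw fun h => hw h.2
    have hij : i ≠ j := fun e => hne (hsingle j w hj hw v (e ▸ hi))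
    obtain ⟨a, ha, b, hb, hab⟩ := hC.touch i j hij
    rwa [hsingle i v hi hv a ha, hsingle j w hj hw b hb] at hab
  have := Fintype.ofFinite V
  -- Hall's theorem matches `X` into its neighbours outside `X`. For a violating `S`, the separation
  -- `(X ∪ N, S'ᶜ)` has order at most `|X \ S'| + |N| < |X|`; some branch set avoids `X ∪ N`, since
  -- this set has fewer than `2 * |X|` elements.
  obtain ⟨f, hfinj, hf⟩ := (Finset.all_card_le_biUnion_card_iff_exists_injective
    (fun x : X => Finset.univ.filter fun v => v ∉ X ∧ G.Adj x v)).1 fun S => by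
      by_contra hlt
      push Not at hlt
      set N : Finset V := S.biUnion fun x : X => Finset.univ.filter fun v => v ∉ X ∧ G.Adj x v
      let S' : Set V := Subtype.val '' (S : Set X)
      have hS' : S'.ncard = S.card := by
        rw [Set.ncard_image_of_injective _ Subtype.val_injective, Set.ncard_coe_finset]
      have hS'X : S' ⊆ X := by rintro _ ⟨x, -, rfl⟩; exact x.2
      have hXS : (X \ S').ncard + S'.ncard = X.ncard :=
        Set.ncard_sdiff_add_ncard_of_subset hS'X (Set.toFinite _)
      have hi : ∃ i, Disjoint (C i) (X ∪ N) := by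
        by_contra hc
        push Not at hc
        simp only [Set.not_disjoint_iff] at hc
        choose g hg hgX using hc
        have ginj : Function.Injective g := fun i j hij => by
          by_contra hne
          exact Set.disjoint_left.1 (hC.disj i j hne) (hg i) (hij ▸ hg j)
        have h1 : Nat.card κ ≤ (X ∪ N : Set V).ncard := by
          rw [← Set.ncard_univ, ← Set.ncard_image_of_injective _ ginj]
          exact Set.ncard_le_ncard (by rintro _ ⟨i, -, rfl⟩; exact hgX i) (Set.toFinite _)
        have h2 := Set.ncard_union_le X (N : Set V)
        rw [Set.ncard_coe_finset] at h2
        omega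
      have h := hatt (X ∪ N) S'ᶜ ⟨fun x => ?_, ?_⟩ Set.subset_union_left hi
      · have h3 : ((X ∪ ↑N) ∩ S'ᶜ : Set V) ⊆ (X \ S') ∪ N := by
          rintro x ⟨hx | hx, hx'⟩
          · exact .inl ⟨hx, hx'⟩
          · exact .inr hx
        have h4 := Set.ncard_le_ncard h3 (Set.toFinite _)
        have h5 := Set.ncard_union_le (X \ S') (N : Set V)
        rw [Set.ncard_coe_finset] at h5
        omega
      · by_cases hx : x ∈ S'
        · exact .inl (.inl (hS'X hx))
        · exact .inr hx
      · rintro a b - ha - hb hab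
        obtain ⟨x, hx, rfl⟩ := not_not.1 ha
        refine hb (.inr ?_)
        simp only [N, Finset.coe_biUnion, Set.mem_iUnion, Finset.coe_filter, Finset.mem_univ,
          true_and, Set.mem_ofPred_eq]
        exact ⟨x, hx, fun h => hb (.inl h), hab⟩
  simp only [Finset.mem_filter, Finset.mem_univ, true_and] at hf
  let g : V → V := fun x => if h : x ∈ X then f ⟨x, h⟩ else x
  have hg : ∀ x ∈ X, g x ∉ X ∧ G.Adj x (g x) := fun x hx => by
    have := hf ⟨x, hx⟩; simpa [g, hx] using this
  have hginj : ∀ x ∈ X, ∀ y ∈ X, x ≠ y → g x ≠ g y := fun x hx y hy hne e => by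
    simp only [g, hx, hy, dif_pos] at e
    exact hne (congrArg Subtype.val (hfinj e))
  refine ⟨fun x => {x} ∪ {g x}, fun x hx => .inl rfl, fun x hx => (linked_singleton x).union
    (linked_singleton _) ⟨x, rfl, g x, rfl, .inr (hg x hx).2⟩, fun x hx y hy hxy => ?_,
    fun x hx y hy hxy => ?_⟩
  · rw [Set.disjoint_left]
    rintro z (rfl | rfl) (h | h)
    · exact hxy h
    · exact (hg y hy).1 (h ▸ hx)
    · exact (hg x hx).1 (h ▸ hy)
    · exact hginj x hx y hy hxy h
  · exact ⟨g x, .inr rfl, g y, .inr rfl, hadj x y _ _ (hg x hx).1 (hg y hy).1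
      (hginj x hx y hy hxy) (hg x hx).2 (hg y hy).2, fun h => (hg x hx).1 h.1⟩

/-! ### Contraction of edges -/

theorem CliqueModel.identify {C : κ → Set V} (hC : CliqueModel G C) {f : V → V}
    (hf : ∀ i j, ∀ x ∈ C i, ∀ y ∈ C j, f x = f y → i = j) :
    CliqueModel (identify G f) (fun i => f '' C i) := by
  refine ⟨fun i => linked_image (hC.linked i) f fun a _ b _ hab hne => ⟨hne, a, b, hab, rfl, rfl⟩,
    fun i j hij => ?_, fun i j hij => ?_⟩
  · rw [Set.disjoint_left]
    rintro _ ⟨x, hx, rfl⟩ ⟨y, hy, hxy⟩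
    exact hij (hf i j x hx y hy hxy.symm)
  · obtain ⟨a, ha, b, hb, hab⟩ := hC.touch i j hij
    exact ⟨f a, ⟨a, ha, rfl⟩, f b, ⟨b, hb, rfl⟩, fun e => hij (hf i j a ha b hb e), a, b, hab,
      rfl, rfl⟩

theorem Sep.of_identify {f : V → V} {A B : Set V} (h : Sep (identify G f) A B) :
    Sep G (f ⁻¹' A) (f ⁻¹' B) :=
  ⟨fun x => h.1 (f x), fun a b ha ha' hb hb' hab => h.2 (f a) (f b) ha ha' hb hb'
    ⟨fun e => ha' (by rw [Set.mem_preimage, e]; exact hb), a, b, hab, rfl, rfl⟩⟩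

/-- Two identified vertices are adjacent, so either a cut splits a fibre and is crossed by that
edge, or it is a union of fibres over `D` and descends to the quotient. -/
theorem Linked.of_identify {f : V → V} (hf : ∀ a b, f a = f b → a = b ∨ G.Adj a b) {D : Set V}
    (hD : Linked (identify G f) D) (hne : ∃ x, f x ∈ D) :
    Linked G (f ⁻¹' D) := by
  refine ⟨hne, ?_⟩
  rintro T ⟨x, hx, hxT⟩ ⟨y, hy, hyT⟩
  by_cases c : ∃ a b, f a ∈ D ∧ f a = f b ∧ a ∈ T ∧ b ∉ T
  · obtain ⟨a, b, ha, hab, haT, hbT⟩ := c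
    refine ⟨a, ha, b, ?_, haT, hbT, (hf a b hab).resolve_left fun e => hbT (e ▸ haT)⟩
    rw [Set.mem_preimage, ← hab]; exact ha
  push Not at c
  obtain ⟨_, ha, _, hb, h1, h2, -, a, b, hab, rfl, rfl⟩ := hD.2 {z | ∃ a ∈ T, f a = z}
    ⟨f x, hx, x, hxT, rfl⟩ ⟨f y, hy, fun ⟨a, haT, ha⟩ => hyT (c a y (ha ▸ hy) ha haT)⟩
  obtain ⟨a', haT, ha'⟩ := h1
  exact ⟨a, ha, b, hb, c a' a (ha' ▸ ha) ha' haT, fun hbT => h2 ⟨b, hbT, rfl⟩, hab⟩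

theorem RootedClique.of_identify {f : V → V} (hf : ∀ a b, f a = f b → a = b ∨ G.Adj a b)
    (hinj : ∀ x ∈ X, ∀ y ∈ X, x ≠ y → f x ≠ f y) {D : V → Set V}
    (hD : RootedClique (identify G f) (f '' X) D) :
    RootedClique G X (fun x => f ⁻¹' D (f x)) := by
  refine ⟨fun x hx => hD.mem _ ⟨x, hx, rfl⟩, fun x hx => (hD.linked _ ⟨x, hx, rfl⟩).of_identify hf
    ⟨x, hD.mem _ ⟨x, hx, rfl⟩⟩, fun x hx y hy hxy => ?_, fun x hx y hy hxy => ?_⟩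
  · exact (hD.disj _ ⟨x, hx, rfl⟩ _ ⟨y, hy, rfl⟩ (hinj x hx y hy hxy)).preimage f
  · obtain ⟨_, ha, _, hb, ⟨-, a, b, hab, rfl, rfl⟩, hX⟩ :=
      hD.touch _ ⟨x, hx, rfl⟩ _ ⟨y, hy, rfl⟩ (hinj x hx y hy hxy)
    exact ⟨a, ha, b, hb, hab, fun h => hX ⟨⟨a, h.1, rfl⟩, ⟨b, h.2, rfl⟩⟩⟩

/-- **Robertson–Seymour**: a set that cannot be separated from a large clique minor by a small
separation is the set of roots of a clique minor. -/
theorem exists_rootedClique [Finite V] [Finite κ] (n : ℕ) : ∀ (G : SimpleGraph V) (X : Set V)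
    (C : κ → Set V), (X ∪ G.support).ncard = n → CliqueModel G C → 2 * X.ncard ≤ Nat.card κ →
    Attached G X C X.ncard → ∃ D, RootedClique G X D := by
  classical
  induction n using Nat.strong_induction_on with
  | _ n ih =>
  intro G X C hn hC hcard hatt
  -- A separation of minimum order that leaves out a vertex of `X ∪ G.support`: pass to the torso of
  -- `B` with roots `A ∩ B`, where the induction measure is smaller because of the omitted vertex.
  by_cases c1 : ∃ A B, Sep G A B ∧ X ⊆ A ∧ (∃ i, Disjoint (C i) A) ∧ (A ∩ B).ncard ≤ X.ncard ∧
      ¬ X ∪ G.support ⊆ B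
  · obtain ⟨A, B, hs, hXA, ⟨i, hi⟩, hle, hB⟩ := c1
    have heq : (A ∩ B).ncard = X.ncard := le_antisymm hle (hatt A B hs hXA ⟨i, hi⟩)
    have hsub : A ∩ B ⊆ X ∪ G.support := by
      rintro w ⟨hwA, hwB⟩
      by_contra hw
      simp only [Set.mem_union, not_or] at hw
      -- A vertex `w` of `A ∩ B` that is isolated and not in `X` could be dropped from `A`, giving
      -- an order below `|X|`.
      have h := hatt (A \ {w}) B ⟨fun x => ?_, ?_⟩ (fun x hx => ⟨hXA hx, fun e => hw.1 (e ▸ hx)⟩)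
        ⟨i, hi.mono_right Set.sdiff_subset⟩
      · have h2 : (A \ {w}) ∩ B = (A ∩ B) \ {w} := by ext; simp; tauto
        have h3 := Set.ncard_sdiff_singleton_lt_of_mem (s := A ∩ B) ⟨hwA, hwB⟩ (Set.toFinite _)
        rw [h2] at h; omega
      · by_cases e : x = w
        · exact .inr (e ▸ hwB)
        · exact (hs.1 x).imp (fun h => ⟨h, e⟩) id
      · rintro a b ⟨haA, -⟩ haB hbB hb hab
        refine hs.2 a b haA haB hbB (fun hbA => hb ⟨hbA, ?_⟩) hab
        rintro rfl
        exact hw.2 ⟨a, hab.symm⟩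
    obtain ⟨w, hw, hwB⟩ := Set.not_subset.1 hB
    have hlt : (A ∩ B ∪ (torso G B (A ∩ B)).support).ncard < n := by
      rw [← hn]
      refine Set.ncard_lt_ncard ⟨?_, fun h => ?_⟩ (Set.toFinite _)
      · rintro x (hx | ⟨y, hxy | hxy⟩)
        · exact hsub hx
        · exact .inr ⟨y, hxy.1⟩
        · exact hsub hxy.2.1
      · rcases h hw with h | ⟨y, h | h⟩
        · exact hwB h.2
        · exact hwB h.2.1
        · exact hwB h.2.1.2
    have hattA : Attached G A C X.ncard := fun A' B' h h' => hatt A' B' h (hXA.trans h')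
    obtain ⟨D, hD⟩ := ih _ hlt _ _ _ rfl (hC.torso hs hi) (heq ▸ hcard)
      (heq ▸ hattA.torso hC hs hi)
    exact rootedClique_of_sep hatt hs hXA ⟨i, hi⟩ hle hD
  push Not at c1
  -- Contract an edge that is neither inside `X` nor between two different branch sets. The vertex
  -- `v` becomes isolated, which lowers the measure.
  by_cases c2 : ∃ u v, G.Adj u v ∧ ¬ (u ∈ X ∧ v ∈ X) ∧ ∀ i j, u ∈ C i → v ∈ C j → i = j
  · obtain ⟨u, v, huv, hX, hCuv⟩ := c2
    let f : V → V := fun w => if w = v then u else w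
    have hfv : f v = u := if_pos rfl
    have hfw : ∀ w, w ≠ v → f w = w := fun w hw => if_neg hw
    have hf' : ∀ a b, f a = f b → a = b ∨ (a = u ∧ b = v) ∨ (a = v ∧ b = u) := fun a b h => by
      by_cases ha : a = v <;> by_cases hb : b = v
      · exact .inl (ha.trans hb.symm)
      · subst ha; rw [hfv, hfw b hb] at h; exact .inr (.inr ⟨rfl, h.symm⟩)
      · subst hb; rw [hfv, hfw a ha] at h; exact .inr (.inl ⟨h, rfl⟩)
      · rw [hfw a ha, hfw b hb] at h; exact .inl h
    have hf : ∀ a b, f a = f b → a = b ∨ G.Adj a b := fun a b h => by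
      rcases hf' a b h with h | ⟨rfl, rfl⟩ | ⟨rfl, rfl⟩
      · exact .inl h
      · exact .inr huv
      · exact .inr huv.symm
    have hinj : ∀ x ∈ X, ∀ y ∈ X, x ≠ y → f x ≠ f y := fun x hx y hy hne h => by
      rcases hf' x y h with h | ⟨rfl, rfl⟩ | ⟨rfl, rfl⟩
      · exact hne h
      · exact hX ⟨hx, hy⟩
      · exact hX ⟨hy, hx⟩
    have hXcard : (f '' X).ncard = X.ncard := Set.InjOn.ncard_image fun x hx y hy h => by
      by_contra hne; exact hinj x hx y hy hne h
    have hfne : ∀ w, f w ≠ v := fun w h => by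
      by_cases hw : w = v
      · subst hw; rw [hfv] at h; exact huv.ne h
      · rw [hfw w hw] at h; exact hw h
    have hlt : (f '' X ∪ (identify G f).support).ncard < n := by
      rw [← hn]
      have hfU : ∀ w ∈ X ∪ G.support, f w ∈ X ∪ G.support := fun w hw => by
        by_cases h : w = v
        · rw [h, hfv]; exact .inr ⟨v, huv⟩
        · rwa [hfw w h]
      refine Set.ncard_lt_ncard ⟨?_, fun h => ?_⟩ (Set.toFinite _)
      · rintro _ (⟨x, hx, rfl⟩ | ⟨_, -, a, b, hab, rfl, -⟩)
        · exact hfU x (.inl hx)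
        · exact hfU a (.inr ⟨b, hab⟩)
      · rcases h (.inr ⟨u, huv.symm⟩ : v ∈ X ∪ G.support) with ⟨x, -, h⟩ | ⟨_, -, a, b, -, h, -⟩
        · exact hfne x h
        · exact hfne a h
    have hC' : CliqueModel (identify G f) (fun i => f '' C i) := hC.identify fun i j x hx y hy h => by
      rcases hf' x y h with h | ⟨rfl, rfl⟩ | ⟨rfl, rfl⟩
      · by_contra hij; exact Set.disjoint_left.1 (hC.disj i j hij) hx (h ▸ hy)
      · exact hCuv i j hx hy
      · exact (hCuv j i hy hx).symm
    have hatt' : Attached (identify G f) (f '' X) (fun i => f '' C i) X.ncard := by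
      rintro A B hs hXA ⟨i, hi⟩
      by_contra hlt
      push Not at hlt
      have hXA' : X ⊆ f ⁻¹' A := fun x hx => hXA ⟨x, hx, rfl⟩
      have hi' : ∃ i, Disjoint (C i) (f ⁻¹' A) := ⟨i, Set.disjoint_left.2 fun x hx hxA =>
        Set.disjoint_left.1 hi ⟨x, hx, rfl⟩ hxA⟩
      have hge := hatt _ _ hs.of_identify hXA' hi'
      -- Undoing the contraction raises the order by at most one, hence to at most `|X|`. By the
      -- failure of `c1` the far side then contains `X`, so the separator is `X` itself. If the
      -- contracted vertex is in `A ∩ B`, both `u` and `v` are in `X`; if not, the order did not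
      -- rise. Both are impossible.
      have hsub : f ⁻¹' A ∩ f ⁻¹' B ⊆ insert v (A ∩ B) := fun w hw => by
        by_cases h : w = v
        · exact .inl h
        · rw [Set.mem_inter_iff, Set.mem_preimage, Set.mem_preimage, hfw w h] at hw
          exact .inr hw
      have hle := Set.ncard_le_ncard hsub (Set.toFinite _)
      have hins := Set.ncard_insert_le v (A ∩ B)
      have hU := c1 _ _ hs.of_identify hXA' hi' (by omega)
      have hXeq : X = f ⁻¹' A ∩ f ⁻¹' B := Set.eq_of_subset_of_ncard_le
        (fun x hx => ⟨hXA' hx, hU (.inl hx)⟩) (by omega) (Set.toFinite _)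
      by_cases hu : u ∈ A ∩ B
      · refine hX ?_
        rw [hXeq]
        simp only [Set.mem_inter_iff, Set.mem_preimage, hfv, hfw u huv.ne]
        exact ⟨hu, hu⟩
      · have : f ⁻¹' A ∩ f ⁻¹' B ⊆ A ∩ B := fun w hw => by
          by_cases h : w = v
          · subst h
            rw [Set.mem_inter_iff, Set.mem_preimage, Set.mem_preimage, hfv] at hw
            exact absurd hw hu
          · rwa [Set.mem_inter_iff, Set.mem_preimage, Set.mem_preimage, hfw w h] at hw
        have := Set.ncard_le_ncard this (Set.toFinite _)
        omega
    obtain ⟨D, hD⟩ := ih _ hlt _ _ _ rfl hC' (hXcard.symm ▸ hcard) (hXcard.symm ▸ hatt')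
    exact ⟨_, hD.of_identify hf hinj⟩
  exact rootedClique_of_matching hC hcard hatt fun u v huv hX => by
    by_contra hc
    exact c2 ⟨u, v, huv, hX, fun i j hi hj => by_contra fun hij => hc ⟨i, j, hi, hj, hij⟩⟩

end Rooted

/-! ### The linkage problem of a disjoint-paths predicate -/

section LinkGraph

variable {V : Type*} {G : SimpleGraph V} {j : ℕ} {s t : Fin j → V}

/-- The list of all terminals. -/
def terminal (s t : Fin j → V) (x : Fin j × Bool) : V := if x.2 then t x.1 else s x.1

/-- The pair `(s i, t i)` cannot be joined by a path without internal vertices. -/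
def NeedsPath (G : SimpleGraph V) (s t : Fin j → V) (i : Fin j) : Prop :=
  s i ≠ t i ∧ ¬ G.Adj (s i) (t i)

/-- The vertex of `G` represented by a vertex of `linkGraph`. -/
def linkProj (s t : Fin j → V) : V ⊕ (Fin j × Bool) → V := Sum.elim id (terminal s t)

/-- The vertices of `linkGraph` that are not isolated by definition. -/
def Usable (G : SimpleGraph V) (s t : Fin j → V) : V ⊕ (Fin j × Bool) → Prop :=
  Sum.elim (fun v => ∀ x, terminal s t x ≠ v) (fun x => NeedsPath G s t x.1)

/-- The graph obtained from `G` by isolating all terminals and adding a separate copy of each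
terminal for each pair it belongs to. -/
def linkGraph (G : SimpleGraph V) (s t : Fin j → V) : SimpleGraph (V ⊕ (Fin j × Bool)) where
  Adj a b := G.Adj (linkProj s t a) (linkProj s t b) ∧ Usable G s t a ∧ Usable G s t b ∧
    (a.isLeft ∨ b.isLeft)
  symm := ⟨fun _ _ h => ⟨h.1.symm, h.2.2.1, h.2.1, h.2.2.2.symm⟩⟩
  loopless := ⟨fun _ h => h.1.ne rfl⟩

/-- There are disjoint connected sets in `H`, one for each `i` with `I i`, containing exactly the
two terminals with index `i`. -/
def Linkable {α : Type*} (H : SimpleGraph (α ⊕ (Fin j × Bool))) (I : Fin j → Prop) : Prop :=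
  ∃ E : Fin j → Set (α ⊕ (Fin j × Bool)),
    (∀ i, I i → Linked H (E i) ∧ ∀ i' b, Sum.inr (i', b) ∈ E i ↔ i' = i) ∧
    ∀ i i', I i → I i' → i ≠ i' → Disjoint (E i) (E i')

theorem linked_image_le {W : Type*} {H : SimpleGraph W} (g : ℕ → W) (n : ℕ)
    (h : ∀ l < n, H.Adj (g l) (g (l + 1))) : Linked H (g '' {l | l ≤ n}) := by
  induction n with
  | zero => simpa using linked_singleton (G := H) (g 0)
  | succ n ih =>
    have he : {l | l ≤ n + 1} = {l | l ≤ n} ∪ {n + 1} := by ext l; simp; omega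
    rw [he, Set.image_union, Set.image_singleton]
    exact (ih fun l hl => h l (by omega)).union (linked_singleton _)
      ⟨g n, ⟨n, le_refl n, rfl⟩, _, rfl, .inr (h n (by omega))⟩

/-- No terminal is internal to any of the paths (`hterm`), so the internal vertices survive in
`linkGraph`, and the private copies of the ends keep paths with common endpoints disjoint. -/
theorem linkable_of_dp (h : DP G s t) : Linkable (linkGraph G s t) (NeedsPath G s t) := by
  obtain ⟨P, hP, hd⟩ := h
  have hterm : ∀ i x, terminal s t x ∉ internalVerts (P i) := by
    rintro i ⟨i', b⟩ hx
    by_cases e : i' = i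
    · subst e
      cases b
      · exact hx.2.1 rfl
      · exact hx.2.2 rfl
    · refine hd i' i e _ ?_ hx
      cases b
      · exact (P i').start_mem_support
      · exact (P i').end_mem_support
  refine ⟨fun i => Sum.inl '' internalVerts (P i) ∪ {x | ∃ b, x = Sum.inr (i, b)}, fun i hi => ⟨?_, ?_⟩,
    fun i i' hi hi' hne => ?_⟩
  · set n := (P i).length with hn
    have hn0 : n ≠ 0 := fun h => hi.1 (SimpleGraph.Walk.eq_of_length_eq_zero h)
    have hn1 : n ≠ 1 := fun h => hi.2 (SimpleGraph.Walk.adj_of_length_eq_one h)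
    have hint : ∀ l, 0 < l → l < n → (P i).getVert l ∈ internalVerts (P i) := fun l h0 h1 => by
      refine ⟨(P i).getVert_mem_support l, fun e => ?_, fun e => ?_⟩
      · have := (hP i).getVert_injOn (x₁ := l) (x₂ := 0) (by simp; omega) (by simp)
          (by rw [e, SimpleGraph.Walk.getVert_zero])
        omega
      · have := (hP i).getVert_injOn (x₁ := l) (x₂ := n) (by simp; omega) (by simp; omega)
          (by rw [e, hn, SimpleGraph.Walk.getVert_length])
        omega
    -- `g` runs along the path, with its two ends replaced by the copies for the pair `i`.
    let g : ℕ → V ⊕ (Fin j × Bool) := fun l =>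
      if l = 0 then .inr (i, false) else if l < n then .inl ((P i).getVert l) else .inr (i, true)
    have hgp : ∀ l ≤ n, linkProj s t (g l) = (P i).getVert l := fun l hl => by
      by_cases h0 : l = 0
      · simp [g, h0, linkProj, terminal]
      · by_cases h1 : l < n
        · simp [g, h0, h1, linkProj]
        · have : l = n := by omega
          subst this
          simp [g, h0, linkProj, terminal, n]
    have hgu : ∀ l, Usable G s t (g l) := fun l => by
      by_cases h0 : l = 0
      · simpa [g, h0, Usable] using hi
      · by_cases h1 : l < n
        · simp only [g, h0, h1, if_false, if_true, Usable, Sum.elim_inl]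
          exact fun x e => hterm i x (e ▸ hint l (by omega) h1)
        · simpa [g, h0, h1, Usable] using hi
    have hrange : g '' {l | l ≤ n} =
        Sum.inl '' internalVerts (P i) ∪ {x | ∃ b, x = Sum.inr (i, b)} := by
      ext w
      constructor
      · rintro ⟨l, hl, rfl⟩
        by_cases h0 : l = 0
        · exact .inr ⟨false, by simp [g, h0]⟩
        · by_cases h1 : l < n
          · exact .inl ⟨_, hint l (by omega) h1, by simp [g, h0, h1]⟩
          · exact .inr ⟨true, by simp [g, h0, h1]⟩
      · rintro (⟨v, hv, rfl⟩ | ⟨b, rfl⟩)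
        · obtain ⟨l, rfl, hl⟩ := SimpleGraph.Walk.mem_support_iff_exists_getVert.1 hv.1
          have h0 : l ≠ 0 := by rintro rfl; exact hv.2.1 (by simp)
          have h1 : l ≠ n := by rintro rfl; exact hv.2.2 (by simp [n])
          have h2 : l < n := by omega
          exact ⟨l, hl, by simp [g, h0, h2]⟩
        · cases b
          · exact ⟨0, by simp, by simp [g]⟩
          · exact ⟨n, by simp, by simp [g, hn0]⟩
    beta_reduce
    rw [← hrange]
    refine linked_image_le g n fun l hl => ⟨?_, hgu l, hgu _, ?_⟩
    · rw [hgp l hl.le, hgp _ hl]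
      exact (P i).adj_getVert_succ hl
    · by_cases h0 : l = 0
      · right; have : 1 < n := by omega
        simp [g, h0, this]
      · left; simp [g, h0, hl]
  · intro i' b
    simp only [Set.mem_union, Set.mem_image, reduceCtorEq, and_false, exists_false, false_or,
      Set.mem_ofPred_eq, Sum.inr.injEq, Prod.mk.injEq]
    exact ⟨fun ⟨_, h⟩ => h.1, fun h => ⟨b, h, rfl⟩⟩
  · rw [Set.disjoint_left]
    rintro _ (⟨v, hv, rfl⟩ | ⟨b, rfl⟩) (⟨w, hw, e⟩ | ⟨b', e⟩)
    · cases e; exact hd i i' hne v hv.1 hw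
    · cases e
    · cases e
    · cases e; exact hne rfl

/-- Project a walk from `E i` to `G` and shorten it to a path; pairs that are equal or adjacent are
joined without internal vertices. An internal vertex lies in one of the sets `E i` and is usable,
hence not a terminal of another pair. -/
theorem dp_of_linkable (h : Linkable (linkGraph G s t) (NeedsPath G s t)) : DP G s t := by
  classical
  obtain ⟨E, hE, hd⟩ := h
  have hus : ∀ i, NeedsPath G s t i → ∀ w ∈ E i, Usable G s t w := fun i hi =>
    (hE i hi).1.subset_of_mem (B := {w | Usable G s t w}) (fun a b h => h.2.2.1)
      (((hE i hi).2 i false).2 rfl) hi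
  have hpath : ∀ i, ∃ P : G.Walk (s i) (t i), P.IsPath ∧ ∀ x ∈ P.support, x = s i ∨ x = t i ∨
      (NeedsPath G s t i ∧ Sum.inl x ∈ E i) := by
    intro i
    by_cases hi : NeedsPath G s t i
    · obtain ⟨w, hw⟩ := exists_walk_of_linked (G := G) (hE i hi).1 (linkProj s t)
        (fun a _ b _ h => h.1) (((hE i hi).2 i false).2 rfl) (((hE i hi).2 i true).2 rfl)
      refine ⟨w.bypass, w.bypass_isPath, fun x hx => ?_⟩
      obtain ⟨y, hy, rfl⟩ := hw x (w.support_bypass_subset_support hx)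
      rcases y with v | ⟨i', b⟩
      · exact .inr (.inr ⟨hi, hy⟩)
      · obtain rfl := ((hE i hi).2 i' b).1 hy
        cases b
        · exact .inl rfl
        · exact .inr (.inl rfl)
    · by_cases he : s i = t i
      · rw [← he]
        exact ⟨.nil, by simp, by simp⟩
      · have ha : G.Adj (s i) (t i) := by by_contra ha; exact hi ⟨he, ha⟩
        refine ⟨ha.toWalk, by simp [he], by simp⟩
  choose P hP hPs using hpath
  refine ⟨P, hP, fun i i' hne x hx hx' => ?_⟩
  have hx' : NeedsPath G s t i' ∧ Sum.inl x ∈ E i' := by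
    rcases hPs i' x hx'.1 with h | h | h
    · exact absurd h hx'.2.1
    · exact absurd h hx'.2.2
    · exact h
  have hxu : ∀ y, terminal s t y ≠ x := hus i' hx'.1 _ hx'.2
  rcases hPs i x hx with h | h | h
  · exact hxu (i, false) h.symm
  · exact hxu (i, true) h.symm
  · exact Set.disjoint_left.1 (hd i i' h.1 hx'.1 hne) h.2 hx'.2

theorem dp_iff_linkable : DP G s t ↔ Linkable (linkGraph G s t) (NeedsPath G s t) :=
  ⟨linkable_of_dp, dp_of_linkable⟩

end LinkGraph

/-! ### Reduction to a bounded torso -/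

section LocalTorso

variable {J W : Type*} {H : SimpleGraph W} {c : J → W}

/-- The elements of `J` whose image has a neighbour outside the image of `c`. -/
def boundary (H : SimpleGraph W) (c : J → W) : Set J := {x | ∃ w, w ∉ Set.range c ∧ H.Adj (c x) w}

/-- The graph induced on the image of `c`, with a clique added on the boundary. -/
def localTorso (H : SimpleGraph W) (c : J → W) : SimpleGraph J where
  Adj x y := H.Adj (c x) (c y) ∨ (x ≠ y ∧ x ∈ boundary H c ∧ y ∈ boundary H c)
  symm := ⟨fun _ _ h => h.imp (fun h => h.symm) fun h => ⟨h.1.symm, h.2.2, h.2.1⟩⟩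
  loopless := ⟨fun _ h => h.elim (fun h => h.ne rfl) fun h => h.1 rfl⟩

/-- The other side of the separation given by the image of `c`. -/
def farSide (H : SimpleGraph W) (c : J → W) : Set W := (Set.range c)ᶜ ∪ c '' boundary H c

theorem sep_farSide : Sep H (Set.range c) (farSide H c) := by
  refine ⟨fun x => ?_, ?_⟩
  · by_cases h : x ∈ Set.range c
    · exact .inl h
    · exact .inr (.inl h)
  · rintro _ b ⟨x, rfl⟩ ha - hb hab
    exact ha (.inr ⟨x, ⟨b, hb, hab⟩, rfl⟩)

theorem range_inter_farSide : Set.range c ∩ farSide H c = c '' boundary H c := by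
  ext w
  constructor
  · rintro ⟨hw, h | h⟩
    · exact absurd hw h
    · exact h
  · rintro ⟨x, hx, rfl⟩
    exact ⟨⟨x, rfl⟩, .inr ⟨x, hx, rfl⟩⟩

theorem Linked.localTorso (hc : Function.Injective c) {S : Set W} (hS : Linked H S)
    (hne : ∃ x, c x ∈ S) : Linked (localTorso H c) (c ⁻¹' S) := by
  obtain ⟨x, hx⟩ := hne
  have h := hS.torso sep_farSide.symm ⟨c x, hx, x, rfl⟩
  rw [Set.inter_comm (farSide H c), range_inter_farSide] at h
  refine ⟨⟨x, hx⟩, ?_⟩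
  rintro T ⟨y, hy, hyT⟩ ⟨z, hz, hzT⟩
  obtain ⟨_, ⟨ha, a, rfl⟩, _, ⟨hb, b, rfl⟩, h1, h2, h3⟩ := h.2 (c '' T)
    ⟨c y, ⟨hy, y, rfl⟩, y, hyT, rfl⟩ ⟨c z, ⟨hz, z, rfl⟩, fun h => hzT ((hc.mem_set_image).1 h)⟩
  refine ⟨a, ha, b, hb, (hc.mem_set_image).1 h1, fun h => h2 ⟨b, h, rfl⟩, ?_⟩
  rcases h3 with h3 | ⟨h3, h4, h5⟩
  · exact .inl h3.1
  · exact .inr ⟨fun e => h3 (by rw [e]), (hc.mem_set_image).1 h4, (hc.mem_set_image).1 h5⟩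

/-- The preimage in the whole graph of a set in the local torso. -/
def unfold (H : SimpleGraph W) (c : J → W) (D : W → Set W) (E : Set J) : Set W :=
  c '' E ∪ {w | ∃ x ∈ E, x ∈ boundary H c ∧ w ∈ D (c x)}

variable {D : W → Set W}

/-- A cut either splits the branch set of some boundary vertex and is crossed inside it, or it comes
from a cut of `E`. There a clique edge is replaced by an edge between two branch sets. -/
theorem linked_unfold (hc : Function.Injective c) (hD : RootedClique H (c '' boundary H c) D)
    {E : Set J} (hE : Linked (localTorso H c) E) : Linked H (unfold H c D E) := by
  obtain ⟨e, he⟩ := hE.1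
  refine ⟨⟨c e, .inl ⟨e, he, rfl⟩⟩, fun T h1 h2 => ?_⟩
  have hsub : ∀ x ∈ E, x ∈ boundary H c → D (c x) ⊆ unfold H c D E := fun x hx hxb w hw =>
    .inr ⟨x, hx, hxb, hw⟩
  have hmem : ∀ x ∈ boundary H c, c x ∈ D (c x) := fun x hx => hD.mem _ ⟨x, hx, rfl⟩
  by_cases hsplit : ∃ x ∈ E, x ∈ boundary H c ∧ ∃ a ∈ D (c x), ∃ b ∈ D (c x), a ∈ T ∧ b ∉ T
  · obtain ⟨x, hx, hxb, a, ha, b, hb, haT, hbT⟩ := hsplit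
    obtain ⟨a, ha, b, hb, h⟩ := (hD.linked _ ⟨x, hxb, rfl⟩).2 T ⟨a, ha, haT⟩ ⟨b, hb, hbT⟩
    exact ⟨a, hsub x hx hxb ha, b, hsub x hx hxb hb, h⟩
  push Not at hsplit
  have h1' : ∃ x ∈ E, c x ∈ T := by
    obtain ⟨_, ⟨x, hx, rfl⟩ | ⟨x, hx, hxb, hw⟩, hwT⟩ := h1
    · exact ⟨x, hx, hwT⟩
    · exact ⟨x, hx, hsplit x hx hxb _ hw _ (hmem x hxb) hwT⟩
  have h2' : ∃ x ∈ E, c x ∉ T := by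
    obtain ⟨w, ⟨x, hx, rfl⟩ | ⟨x, hx, hxb, hw⟩, hwT⟩ := h2
    · exact ⟨x, hx, hwT⟩
    · exact ⟨x, hx, fun h => hwT (hsplit x hx hxb _ (hmem x hxb) _ hw h)⟩
  obtain ⟨a, ha, b, hb, haT, hbT, hab | ⟨hab, hab1, hab2⟩⟩ := hE.2 (c ⁻¹' T) h1' h2'
  · exact ⟨c a, .inl ⟨a, ha, rfl⟩, c b, .inl ⟨b, hb, rfl⟩, haT, hbT, hab⟩
  · obtain ⟨p, hp, q, hq, hpq, -⟩ := hD.touch _ ⟨a, hab1, rfl⟩ _ ⟨b, hab2, rfl⟩ (hc.ne hab)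
    exact ⟨p, hsub a ha hab1 hp, q, hsub b hb hab2 hq,
      hsplit a ha hab1 _ (hmem a hab1) _ hp haT,
      fun h => hbT (hsplit b hb hab2 _ hq _ (hmem b hab2) h), hpq⟩

/-- Branch sets stay on the far side and are disjoint, so each meets the part only in its own root.
-/
theorem mem_unfold (hc : Function.Injective c) (hD : RootedClique H (c '' boundary H c) D)
    (hDB : ∀ x ∈ c '' boundary H c, D x ⊆ farSide H c) {E : Set J} {x : J} :
    c x ∈ unfold H c D E ↔ x ∈ E := by
  refine ⟨?_, fun h => .inl ⟨x, h, rfl⟩⟩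
  rintro (⟨y, hy, hxy⟩ | ⟨y, hy, hyb, hxy⟩)
  · rwa [← hc hxy]
  · have hx : c x ∈ c '' boundary H c := by
      rw [← range_inter_farSide]; exact ⟨⟨x, rfl⟩, hDB _ ⟨y, hyb, rfl⟩ hxy⟩
    by_contra hxE
    refine Set.disjoint_left.1 (hD.disj (c y) ⟨y, hyb, rfl⟩ (c x) hx fun e => hxE ?_) hxy
      (hD.mem _ hx)
    rwa [← hc e]

theorem disjoint_unfold (hc : Function.Injective c) (hD : RootedClique H (c '' boundary H c) D)
    (hDB : ∀ x ∈ c '' boundary H c, D x ⊆ farSide H c) {E E' : Set J} (h : Disjoint E E') :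
    Disjoint (unfold H c D E) (unfold H c D E') := by
  rw [Set.disjoint_left]
  intro w hw hw'
  by_cases hr : ∃ x, c x = w
  · obtain ⟨x, rfl⟩ := hr
    exact Set.disjoint_left.1 h ((mem_unfold hc hD hDB).1 hw) ((mem_unfold hc hD hDB).1 hw')
  · rcases hw with ⟨x, -, hx⟩ | ⟨x, hx, hxb, hxw⟩
    · exact hr ⟨x, hx⟩
    rcases hw' with ⟨y, -, hy⟩ | ⟨y, hy, hyb, hyw⟩
    · exact hr ⟨y, hy⟩
    exact Set.disjoint_left.1 (hD.disj _ ⟨x, hxb, rfl⟩ _ ⟨y, hyb, rfl⟩ fun e =>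
      Set.disjoint_left.1 h hx (hc e ▸ hy)) hxw hyw

/-- Linkages in a graph correspond to linkages in the local torso. -/
theorem linkable_localTorso {α β : Type*} {j : ℕ} {H : SimpleGraph (α ⊕ (Fin j × Bool))}
    {a : β → α} (ha : Function.Injective a) {D : α ⊕ (Fin j × Bool) → Set (α ⊕ (Fin j × Bool))}
    (hD : RootedClique H (Sum.map a id '' boundary H (Sum.map a id)) D)
    (hDB : ∀ x ∈ Sum.map a id '' boundary H (Sum.map a id), D x ⊆ farSide H (Sum.map a id))
    (I : Fin j → Prop) : Linkable H I ↔ Linkable (localTorso H (Sum.map a id)) I := by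
  have hc : Function.Injective (Sum.map a id : β ⊕ (Fin j × Bool) → α ⊕ (Fin j × Bool)) :=
    Function.Injective.sumMap ha Function.injective_id
  constructor
  · rintro ⟨E, hE, hd⟩
    exact ⟨fun i => Sum.map a id ⁻¹' E i, fun i hi => ⟨(hE i hi).1.localTorso hc
      ⟨.inr (i, false), ((hE i hi).2 i false).2 rfl⟩, (hE i hi).2⟩,
      fun i i' hi hi' hne => (hd i i' hi hi' hne).preimage _⟩
  · rintro ⟨E, hE, hd⟩
    exact ⟨fun i => unfold H (Sum.map a id) D (E i), fun i hi => ⟨linked_unfold hc hD (hE i hi).1,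
      fun i' b => (mem_unfold hc hD hDB (x := .inr (i', b))).trans ((hE i hi).2 i' b)⟩,
      fun i i' hi hi' hne => disjoint_unfold hc hD hDB (hd i i' hi hi' hne)⟩

end LocalTorso

/-! ### A bounded criterion for disjoint paths -/

section Criterion

variable {V : Type u} {G : SimpleGraph V} {j : ℕ} {s t : Fin j → V}

/-- An injective tuple of vertices other than the terminals. -/
def Admissible (s t : Fin j → V) {n : ℕ} (a : Fin n → V) : Prop :=
  (∀ l l', a l = a l' → l = l') ∧ ∀ l x, terminal s t x ≠ a l

/-- The number of boundary vertices of the part of `linkGraph` given by `a` and all terminals. -/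
noncomputable def weight (G : SimpleGraph V) (s t : Fin j → V) {n : ℕ} (a : Fin n → V) : ℕ :=
  (boundary (linkGraph G s t) (Sum.map a id)).ncard

/-- The linkage problem is solvable in the torso of the part given by `a`. -/
def LocallyLinkable (G : SimpleGraph V) (s t : Fin j → V) {n : ℕ} (a : Fin n → V) : Prop :=
  Linkable (localTorso (linkGraph G s t) (Sum.map a id)) (NeedsPath G s t)

/-- The linkage problem is solvable in the torso of a part of size at most `L` of least weight. -/
def Criterion (L : ℕ) (G : SimpleGraph V) (s t : Fin j → V) : Prop :=
  ∃ m : Fin (2 * j + 1),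
    (∃ n : Fin (L + 1), ∃ a : Fin n → V,
      Admissible s t a ∧ weight G s t a ≤ m ∧ LocallyLinkable G s t a) ∧
    ∀ n : Fin (L + 1), ∀ a : Fin n → V, Admissible s t a → ↑m ≤ weight G s t a

theorem unbreakable_sets {q p : ℕ} (h : Unbreakable G q p) {A B : Set V} (hs : Sep G A B)
    (hle : (A ∩ B).ncard ≤ p) : A.ncard ≤ q ∨ B.ncard ≤ q := by
  have := h ((⊤ : G.Subgraph).induce A) ((⊤ : G.Subgraph).induce B)
    ⟨Set.eq_univ_of_forall hs.1, fun a ha b hb => hs.2 a b ha.1 ha.2 hb.1 hb.2⟩ hle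
  simpa using this

theorem card_terminals_le : (Set.range (terminal s t)).ncard ≤ 2 * j := by
  rw [← Set.image_univ]
  refine (Set.ncard_image_le (Set.toFinite _)).trans ?_
  rw [Set.ncard_univ]
  simp [mul_comm]

/-- The branch sets without terminals of a clique minor of `G` form one of `linkGraph G s t`. -/
theorem cliqueModel_linkGraph {ι : Type*} {B : ι → Set V} (hB : CliqueModel G B) :
    CliqueModel (linkGraph G s t)
      (fun i : {i // ∀ x, terminal s t x ∉ B i} => (Sum.inl '' B i : Set (V ⊕ (Fin j × Bool)))) := by
  have hadj : ∀ i i' : {i // ∀ x, terminal s t x ∉ B i}, ∀ a ∈ B i, ∀ b ∈ B i', G.Adj a b →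
      (linkGraph G s t).Adj (Sum.inl a) (Sum.inl b) := fun i i' a ha b hb hab =>
    ⟨hab, fun x h => i.2 x (h ▸ ha), fun x h => i'.2 x (h ▸ hb), .inl rfl⟩
  refine ⟨fun i => linked_image (hB.linked i) _ fun a ha b hb hab _ => hadj i i a ha b hb hab,
    fun i i' hne => ?_, fun i i' hne => ?_⟩
  · exact (Set.disjoint_image_iff Sum.inl_injective).2 (hB.disj _ _ fun e => hne (Subtype.ext e))
  · obtain ⟨a, ha, b, hb, hab⟩ := hB.touch _ _ fun e => hne (Subtype.ext e)
    exact ⟨_, ⟨a, ha, rfl⟩, _, ⟨b, hb, rfl⟩, hadj i i' a ha b hb hab⟩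

/-- Pairwise disjoint sets meeting a finite set are at most as many as its elements. -/
theorem card_le_of_meets [Finite V] {ι : Type*} {B : ι → Set V}
    (hB : ∀ i i', i ≠ i' → Disjoint (B i) (B i')) {S : Set V} (hS : ∀ i, ∃ x ∈ B i, x ∈ S) :
    Nat.card ι ≤ S.ncard := by
  choose g hg hgS using hS
  have ginj : Function.Injective g := fun i i' h => by
    by_contra hne
    exact Set.disjoint_left.1 (hB i i' hne) (hg i) (h ▸ hg i')
  rw [← Set.ncard_univ, ← Set.ncard_image_of_injective _ ginj]
  exact Set.ncard_le_ncard (by rintro _ ⟨i, -, rfl⟩; exact hgS i) (Set.toFinite _)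

theorem card_terminalFree [Finite V] {T : ℕ} {B : Fin T → Set V} (hB : CliqueModel G B) :
    T ≤ 2 * j + Nat.card {i // ∀ x, terminal s t x ∉ B i} := by
  have h1 : Nat.card {i // ¬ ∀ x, terminal s t x ∉ B i} ≤ 2 * j := by
    refine le_trans ?_ (card_terminals_le (s := s) (t := t))
    refine card_le_of_meets (B := fun i : {i // ¬ ∀ x, terminal s t x ∉ B i} => B i)
      (fun i i' hne => hB.disj _ _ fun e => hne (Subtype.ext e)) fun i => ?_
    have := i.2
    push Not at this
    obtain ⟨x, hx⟩ := this
    exact ⟨_, hx, x, rfl⟩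
  have h2 : Nat.card {i // ∀ x, terminal s t x ∉ B i} +
      Nat.card {i // ¬ ∀ x, terminal s t x ∉ B i} = T := by
    classical
    rw [← Nat.card_sum, Nat.card_congr (Equiv.sumCompl _), Nat.card_fin]
  omega

theorem weight_nil_le (a : Fin 0 → V) : weight G s t a ≤ 2 * j := by
  unfold weight
  refine (Set.ncard_le_card _).trans ?_
  simp [mul_comm]

/-- A part all of whose vertices lie on one side of a separation that has all terminals on that
side can be replaced by that side. -/
theorem exists_admissible_of_sep [Finite V] {L : ℕ} {A B : Set (V ⊕ (Fin j × Bool))}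
    (hs : Sep (linkGraph G s t) A B) (hA : ∀ x, Sum.inr x ∈ A)
    (hL : {v | Sum.inl v ∈ A ∧ ∀ x, terminal s t x ≠ v}.ncard ≤ L) :
    ∃ n : Fin (L + 1), ∃ a : Fin n → V, Admissible s t a ∧ weight G s t a ≤ (A ∩ B).ncard := by
  set S : Set V := {v | Sum.inl v ∈ A ∧ ∀ x, terminal s t x ≠ v} with hS
  have e : S ≃ Fin S.ncard := Finite.equivFinOfCardEq rfl
  let a : Fin S.ncard → V := fun l => (e.symm l).1
  have haS : ∀ l, a l ∈ S := fun l => (e.symm l).2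
  have hinj : ∀ l l', a l = a l' → l = l' := fun l l' h => e.symm.injective (Subtype.ext h)
  refine ⟨⟨S.ncard, by omega⟩, a, ⟨hinj, fun l => (haS l).2⟩, ?_⟩
  have hc : Function.Injective (Sum.map a id : Fin S.ncard ⊕ (Fin j × Bool) → V ⊕ (Fin j × Bool)) :=
    Function.Injective.sumMap hinj Function.injective_id
  unfold weight
  rw [← Set.ncard_image_of_injective _ hc]
  refine Set.ncard_le_ncard ?_ (Set.toFinite _)
  rintro _ ⟨x, ⟨w, hw, hadj⟩, rfl⟩
  have hxA : Sum.map a id x ∈ A := by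
    rcases x with l | x
    · exact (haS l).1
    · exact hA x
  -- An outside neighbour is not a copy, because all copies belong to the part. It is usable, hence
  -- not a terminal, so if it were in `A` it would be enumerated by `a`.
  have hwA : w ∉ A := by
    rcases w with v | x
    · intro hv
      refine hw ⟨.inl (e ⟨v, hv, hadj.2.2.1⟩), ?_⟩
      simp [a]
    · exact absurd ⟨.inr x, rfl⟩ hw
  refine ⟨hxA, ?_⟩
  by_contra hxB
  exact hs.2 _ _ hxA hxB ((hs.1 w).resolve_left hwA) hwA hadj

/-- A part of least weight is attached to a rooted clique minor outside it. -/
theorem exists_rootedClique_of_least [Finite V] {k L T : ℕ} (hj : 1 ≤ j) (hjk : j ≤ k)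
    (hT : T = max (6 * k ^ 3) (2 * k * L)) (hU : Unbreakable G L (4 * k ^ 3))
    {B : Fin T → Set V} (hB : CliqueModel G B)
    {n : ℕ} (hn : n ≤ L) {a : Fin n → V} (ha : Admissible s t a)
    (hmin : ∀ n : Fin (L + 1), ∀ a' : Fin n → V, Admissible s t a' →
      weight G s t a ≤ weight G s t a') :
    ∃ D, RootedClique (linkGraph G s t)
        (Sum.map a id '' boundary (linkGraph G s t) (Sum.map a id)) D ∧
      ∀ x ∈ Sum.map a id '' boundary (linkGraph G s t) (Sum.map a id),
        D x ⊆ farSide (linkGraph G s t) (Sum.map a id) := by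
  classical
  set H := linkGraph G s t with hH
  set c : Fin n ⊕ (Fin j × Bool) → V ⊕ (Fin j × Bool) := Sum.map a id with hcdef
  have hc : Function.Injective c := Function.Injective.sumMap (fun _ _ => ha.1 _ _)
    Function.injective_id
  have hk : 6 * k ≤ 6 * k ^ 3 := Nat.mul_le_mul_left 6 (Nat.le_self_pow (by norm_num) k)
  have hT1 : 6 * k ^ 3 ≤ T := hT ▸ le_max_left _ _
  have hT2 : 2 * L ≤ T := by
    refine le_trans ?_ (hT ▸ le_max_right _ _)
    exact Nat.mul_le_mul_right L (by omega)
  have hwt : (c '' boundary H c).ncard = weight G s t a := Set.ncard_image_of_injective _ hc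
  have hw2 : weight G s t a ≤ 2 * j := (hmin ⟨0, by omega⟩ Fin.elim0
    ⟨fun l => l.elim0, fun l => l.elim0⟩).trans (weight_nil_le _)
  have hC := cliqueModel_linkGraph (s := s) (t := t) hB
  set κ := {i // ∀ x, terminal s t x ∉ B i}
  have hfree : T ≤ 2 * j + Nat.card κ := card_terminalFree hB
  -- From `T ≥ 6 * k` and `T ≥ 2 * L` follows `T ≥ L + 3 * k`, so there are more than `L`
  -- terminal-free branch sets and one of them avoids the part.
  obtain ⟨i₀, hi₀⟩ : ∃ i₀ : κ, Disjoint (Sum.inl '' B i₀) (Set.range c) := by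
    by_contra hno
    push Not at hno
    have h1 : Nat.card κ ≤ (Set.range a).ncard := by
      refine card_le_of_meets (B := fun i : κ => B i)
        (fun i i' hne => hB.disj _ _ fun e => hne (Subtype.ext e)) fun i => ?_
      obtain ⟨_, ⟨v, hv, rfl⟩, ⟨l | x, hx⟩⟩ := Set.not_disjoint_iff.1 (hno i)
      · exact ⟨v, hv, l, Sum.inl_injective hx⟩
      · cases hx
    have h2 : (Set.range a).ncard ≤ n := by
      rw [← Set.image_univ]
      refine (Set.ncard_image_le (Set.toFinite _)).trans ?_
      rw [Set.ncard_univ, Nat.card_fin]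
    omega
  have hatt : Attached H (Set.range c) (fun i : κ => (Sum.inl '' B i : Set (V ⊕ (Fin j × Bool))))
      (weight G s t a) := by
    rintro A₂ B₂ hs hA ⟨i, hi⟩
    by_contra hlt
    push Not at hlt
    -- With the terminals put on both sides, the separation of `H` becomes one of `G`, of order less
    -- than `2 * j + 2 * j`, which is at most `4 * k ^ 3`.
    let Z : Set V := Set.range (terminal s t)
    let A₃ : Set V := Z ∪ Sum.inl ⁻¹' A₂
    let B₃ : Set V := Z ∪ Sum.inl ⁻¹' B₂
    have hs₃ : Sep G A₃ B₃ := by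
      refine ⟨fun x => (hs.1 (.inl x)).imp .inr .inr, ?_⟩
      intro v w hv hvB hw hwA hvw
      simp only [A₃, B₃, Set.mem_union, not_or] at hv hvB hw hwA
      exact hs.2 (.inl v) (.inl w) (hv.resolve_left hvB.1) hvB.2 (hw.resolve_left hwA.1) hwA.2
        ⟨hvw, fun x h => hvB.1 ⟨x, h⟩, fun x h => hwA.1 ⟨x, h⟩, .inl rfl⟩
    have hord : (A₃ ∩ B₃).ncard ≤ 4 * k ^ 3 := by
      have h1 : A₃ ∩ B₃ ⊆ Z ∪ Sum.inl ⁻¹' (A₂ ∩ B₂) := by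
        rintro v ⟨hv | hv, hv' | hv'⟩
        · exact .inl hv
        · exact .inl hv
        · exact .inl hv'
        · exact .inr ⟨hv, hv'⟩
      have h2 := Set.ncard_le_ncard h1 (Set.toFinite _)
      have h3 := Set.ncard_union_le Z (Sum.inl ⁻¹' (A₂ ∩ B₂))
      have h4 : Z.ncard ≤ 2 * j := card_terminals_le
      have h5 : (Sum.inl ⁻¹' (A₂ ∩ B₂) : Set V).ncard ≤ (A₂ ∩ B₂).ncard := by
        rw [← Set.ncard_image_of_injective _ Sum.inl_injective]
        exact Set.ncard_le_ncard (Set.image_preimage_subset _ _) (Set.toFinite _)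
      omega
    have hnotB : ¬ B₃.ncard ≤ L := by
      intro hBL
      -- Branch set `i` lies beyond `A₃`, and every other one is adjacent to it, so all `T` disjoint
      -- branch sets meet `B₃`, while `T > L`.
      have h1 : Nat.card (Fin T) ≤ B₃.ncard := by
        have hiA : ∀ v ∈ B i, v ∉ A₃ := by
          rintro v hv (⟨x, rfl⟩ | hvA)
          · exact i.2 x hv
          · exact Set.disjoint_left.1 hi ⟨v, hv, rfl⟩ hvA
        refine card_le_of_meets hB.disj fun l => ?_
        by_cases hl : l = i
        · obtain ⟨v, hv⟩ := (hB.linked l).1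
          exact ⟨v, hv, (hs₃.1 v).resolve_left (hiA v (hl ▸ hv))⟩
        · obtain ⟨v, hv, w, hw, hvw⟩ := hB.touch l i hl
          refine ⟨v, hv, ?_⟩
          by_contra hvB
          exact hs₃.2 v w ((hs₃.1 v).resolve_right hvB) hvB
            ((hs₃.1 w).resolve_left (hiA w hw)) (hiA w hw) hvw
      rw [Nat.card_fin] at h1
      omega
    have hAL : A₃.ncard ≤ L := (unbreakable_sets hU hs₃ hord).resolve_right hnotB
    -- The near side is itself a part of size at most `L`, with a boundary smaller than the least
    -- one.
    obtain ⟨n', a', ha', hle⟩ := exists_admissible_of_sep (L := L) hs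
      (fun x => hA ⟨.inr x, rfl⟩)
      ((Set.ncard_le_ncard (fun v hv => .inr hv.1) (Set.toFinite _)).trans hAL)
    have := hmin n' a' ha'
    omega
  have hs : Sep H (Set.range c) (farSide H c) := sep_farSide
  have hC' := hC.torso hs hi₀
  have hatt' := hatt.torso hC hs hi₀
  rw [range_inter_farSide] at hC' hatt'
  rw [← hwt] at hatt'
  -- At most `4 * j` roots are counted on the left; at least `6 * k - 2 * j` branch sets remain.
  have hcard : 2 * (c '' boundary H c).ncard ≤ Nat.card κ := by omega
  obtain ⟨D, hD⟩ := exists_rootedClique _ _ _ _ rfl hC' hcard hatt'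
  obtain ⟨h1, h2⟩ := hD.of_torso (by rw [← range_inter_farSide]; exact Set.inter_subset_right)
  exact ⟨D, h1, h2⟩

/-- In unbreakable graphs with a large clique minor, disjoint paths exist if and only if the
bounded criterion holds. -/
theorem dp_iff_criterion [Finite V] {k L T : ℕ} (hj : 1 ≤ j) (hjk : j ≤ k)
    (hT : T = max (6 * k ^ 3) (2 * k * L)) (hU : Unbreakable G L (4 * k ^ 3))
    (hM : IsMinor (SimpleGraph.completeGraph (Fin T)) G) : DP G s t ↔ Criterion L G s t := by
  classical
  obtain ⟨B, hB1, hB2, hB3⟩ := hM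
  have hB : CliqueModel G B := ⟨fun i => linked_of_connected (hB1 i), hB2, fun i i' h => hB3 i i' h⟩
  -- Every part of least weight decides the instance, whichever one is chosen; this gives both
  -- directions.
  have key : ∀ {n : ℕ} (hn : n ≤ L) {a : Fin n → V} (ha : Admissible s t a)
      (hmin : ∀ n : Fin (L + 1), ∀ a' : Fin n → V, Admissible s t a' →
        weight G s t a ≤ weight G s t a'), DP G s t ↔ LocallyLinkable G s t a := by
    intro n hn a ha hmin
    obtain ⟨D, hD, hDB⟩ := exists_rootedClique_of_least hj hjk hT hU hB hn ha hmin
    rw [dp_iff_linkable]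
    exact linkable_localTorso (fun _ _ => ha.1 _ _) hD hDB _
  constructor
  · intro h
    have hex : ∃ m, ∃ n : Fin (L + 1), ∃ a : Fin n → V, Admissible s t a ∧ weight G s t a = m :=
      ⟨_, ⟨0, by omega⟩, Fin.elim0, ⟨fun l => l.elim0, fun l => l.elim0⟩, rfl⟩
    have hmin : ∀ n : Fin (L + 1), ∀ a : Fin n → V, Admissible s t a →
        Nat.find hex ≤ weight G s t a := fun n a ha => Nat.find_min' hex ⟨n, a, ha, rfl⟩
    obtain ⟨n, a, ha, hw⟩ := Nat.find_spec hex
    have hle : Nat.find hex ≤ 2 * j := (hmin ⟨0, by omega⟩ Fin.elim0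
      ⟨fun l => l.elim0, fun l => l.elim0⟩).trans (weight_nil_le _)
    exact ⟨⟨Nat.find hex, by omega⟩, ⟨n, a, ha, hw.le,
      (key (by omega) ha fun n' a' ha' => hw ▸ hmin n' a' ha').1 h⟩, hmin⟩
  · rintro ⟨m, ⟨n, a, ha, hw, hl⟩, hmin⟩
    exact (key (by omega) ha fun n' a' ha' => hw.trans (hmin n' a' ha')).2 hl

end Criterion

/-! ### Definability on a class of rooted coloured graphs -/

section Definability

variable {h : ℕ} {Λ : Finset ℕ} {ι : Type}

/-- The property `P` of tuples indexed by `α` is first-order definable, uniformly on the class `C`,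
from the edge relation and the unary predicates `U`. -/
def DefOn (U : ∀ V : Type u, RootedGraph h Λ V → Set V → ι → Set V)
    (C : ∀ V : Type u, RootedGraph h Λ V → Prop) {α : Type}
    (P : ∀ V : Type u, RootedGraph h Λ V → Set V → (α → V) → Prop) : Prop :=
  ∃ φ : (graphLang ι).Formula α, ∀ V G R, C V G → ∀ v : α → V,
    (letI := graphStructure G.graph (U V G R); φ.Realize v) ↔ P V G R v

variable {U : ∀ V : Type u, RootedGraph h Λ V → Set V → ι → Set V}
  {C : ∀ V : Type u, RootedGraph h Λ V → Prop} {α : Type}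
  {P Q : ∀ V : Type u, RootedGraph h Λ V → Set V → (α → V) → Prop}

/-! ### Closure of definability under Boolean operations and quantifiers -/

theorem DefOn.congr (hP : DefOn U C P) (hPQ : ∀ V G R, C V G → ∀ v, P V G R v ↔ Q V G R v) :
    DefOn U C Q :=
  hP.imp fun _ hφ V G R hC v => (hφ V G R hC v).trans (hPQ V G R hC v)

theorem DefOn.not (hP : DefOn U C P) : DefOn U C fun V G R v => ¬ P V G R v := by
  obtain ⟨φ, hφ⟩ := hP
  exact ⟨φ.not, fun V G R hC v => not_congr (hφ V G R hC v)⟩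

theorem DefOn.and (hP : DefOn U C P) (hQ : DefOn U C Q) :
    DefOn U C fun V G R v => P V G R v ∧ Q V G R v := by
  obtain ⟨φ, hφ⟩ := hP
  obtain ⟨ψ, hψ⟩ := hQ
  refine ⟨φ ⊓ ψ, fun V G R hC v => ?_⟩
  let := graphStructure G.graph (U V G R)
  exact FirstOrder.Language.Formula.realize_inf.trans
    (and_congr (hφ V G R hC v) (hψ V G R hC v))

theorem DefOn.or (hP : DefOn U C P) (hQ : DefOn U C Q) :
    DefOn U C fun V G R v => P V G R v ∨ Q V G R v :=
  (hP.not.and hQ.not).not.congr fun _ _ _ _ _ => by tauto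

theorem DefOn.imp (hP : DefOn U C P) (hQ : DefOn U C Q) :
    DefOn U C fun V G R v => P V G R v → Q V G R v :=
  (hP.not.or hQ).congr fun _ _ _ _ _ => by tauto

theorem DefOn.iff (hP : DefOn U C P) (hQ : DefOn U C Q) :
    DefOn U C fun V G R v => (P V G R v ↔ Q V G R v) :=
  ((hP.imp hQ).and (hQ.imp hP)).congr fun _ _ _ _ _ => by tauto

theorem defOn_const (p : Prop) : DefOn U C (α := α) fun _ _ _ _ => p := by
  by_cases hp : p
  · refine ⟨⊤, fun V G R _ v => ?_⟩
    let := graphStructure G.graph (U V G R)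
    exact iff_of_true (FirstOrder.Language.BoundedFormula.realize_top.2 trivial) hp
  · refine ⟨⊥, fun V G R _ v => ?_⟩
    let := graphStructure G.graph (U V G R)
    exact iff_of_false id hp

theorem DefOn.forall_fin {β : Type*} [Finite β]
    {P : β → ∀ V : Type u, RootedGraph h Λ V → Set V → (α → V) → Prop}
    (hP : ∀ b, DefOn U C (P b)) : DefOn U C fun V G R v => ∀ b, P b V G R v := by
  choose φ hφ using hP
  refine ⟨FirstOrder.Language.Formula.iInf φ, fun V G R hC v => ?_⟩
  let := graphStructure G.graph (U V G R)
  exact FirstOrder.Language.Formula.realize_iInf.trans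
    (forall_congr' fun b => hφ b V G R hC v)

theorem DefOn.exists_fin {β : Type*} [Finite β]
    {P : β → ∀ V : Type u, RootedGraph h Λ V → Set V → (α → V) → Prop}
    (hP : ∀ b, DefOn U C (P b)) : DefOn U C fun V G R v => ∃ b, P b V G R v :=
  (DefOn.forall_fin fun b => (hP b).not).not.congr fun _ _ _ _ _ => by simp

theorem DefOn.exists_tuple {β : Type} [Finite β]
    {P : ∀ V : Type u, RootedGraph h Λ V → Set V → (α ⊕ β → V) → Prop}
    (hP : DefOn U C P) : DefOn U C fun V G R v => ∃ a : β → V, P V G R (Sum.elim v a) := by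
  obtain ⟨φ, hφ⟩ := hP
  refine ⟨φ.iExs β, fun V G R hC v => ?_⟩
  let := graphStructure G.graph (U V G R)
  exact FirstOrder.Language.Formula.realize_iExs.trans
    (exists_congr fun b => hφ V G R hC _)

theorem DefOn.forall_tuple {β : Type} [Finite β]
    {P : ∀ V : Type u, RootedGraph h Λ V → Set V → (α ⊕ β → V) → Prop}
    (hP : DefOn U C P) : DefOn U C fun V G R v => ∀ a : β → V, P V G R (Sum.elim v a) :=
  hP.not.exists_tuple.not.congr fun _ _ _ _ _ => by simp

theorem DefOn.exists_vertex
    {P : ∀ V : Type u, RootedGraph h Λ V → Set V → (α ⊕ Unit → V) → Prop}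
    (hP : DefOn U C P) :
    DefOn U C fun V G R v => ∃ y : V, P V G R (Sum.elim v fun _ => y) :=
  hP.exists_tuple.congr fun _ _ _ _ _ =>
    ⟨fun ⟨a, ha⟩ => ⟨a (), ha⟩, fun ⟨y, hy⟩ => ⟨fun _ => y, hy⟩⟩

/-- A property determined by finitely many definable properties is definable. -/
theorem DefOn.of_code {β : Type*} [Finite β]
    {Q : β → ∀ V : Type u, RootedGraph h Λ V → Set V → (α → V) → Prop}
    (hQ : ∀ b, DefOn U C (Q b)) (F : (β → Prop) → Prop) :
    DefOn U C fun V G R v => F fun b => Q b V G R v := by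
  -- The disjunction runs over all truth assignments `X` accepted by `F`. This makes arbitrary
  -- conditions on bounded structures definable without writing formulas for them.
  refine (DefOn.exists_fin fun X : β → Prop => (defOn_const (F X)).and
    (DefOn.forall_fin fun b => (hQ b).iff (defOn_const (X b)))).congr fun V G R _ v => ?_
  constructor
  · rintro ⟨X, hX, hb⟩
    rwa [show (fun b => Q b V G R v) = X from funext fun b => propext (hb b)]
  · exact fun hF => ⟨_, hF, fun _ => Iff.rfl⟩

theorem defOn_eq (x y : α) : DefOn U C fun _ _ _ v => v x = v y := by
  refine ⟨(FirstOrder.Language.Term.var x).equal (FirstOrder.Language.Term.var y),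
    fun V G R _ v => ?_⟩
  let := graphStructure G.graph (U V G R)
  exact FirstOrder.Language.Formula.realize_equal

theorem defOn_adj (x y : α) : DefOn U C fun _ G _ v => G.graph.Adj (v x) (v y) := by
  refine ⟨FirstOrder.Language.Relations.formula (L := graphLang ι) (n := 2) GraphRel.edge
    ![.var x, .var y], fun V G R _ v => ?_⟩
  let := graphStructure G.graph (U V G R)
  exact FirstOrder.Language.Formula.realize_rel

theorem defOn_unary (i : ι) (x : α) : DefOn U C fun V G R v => v x ∈ U V G R i := by
  refine ⟨FirstOrder.Language.Relations.formula (L := graphLang ι) (n := 1) (GraphRel.unary i)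
    ![.var x], fun V G R _ v => ?_⟩
  let := graphStructure G.graph (U V G R)
  exact FirstOrder.Language.Formula.realize_rel

/-! ### Definability of the criterion -/

section Criterion

variable {j n : ℕ} (σ τ : Fin j → α) (ρ : Fin n → α)

/-- The variable for an element of the part of `linkGraph` given by `ρ` and all terminals. -/
def partVar : Fin n ⊕ (Fin j × Bool) → α :=
  Sum.elim ρ fun x => if x.2 then τ x.1 else σ x.1

theorem terminal_comp {V : Type*} (v : α → V) (x : Fin j × Bool) :
    terminal (v ∘ σ) (v ∘ τ) x = v (partVar σ τ ρ (.inr x)) := by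
  obtain ⟨i, b⟩ := x
  cases b <;> rfl

theorem linkProj_comp {V : Type*} (v : α → V) (x : Fin n ⊕ (Fin j × Bool)) :
    linkProj (v ∘ σ) (v ∘ τ) (Sum.map (v ∘ ρ) id x) = v (partVar σ τ ρ x) := by
  rcases x with l | x
  · rfl
  · exact terminal_comp σ τ ρ v x

theorem defOn_needsPath (i : Fin j) :
    DefOn U C fun _ G _ v => NeedsPath G.graph (v ∘ σ) (v ∘ τ) i :=
  (defOn_eq (σ i) (τ i)).not.and (defOn_adj (σ i) (τ i)).not

theorem defOn_not_terminal (y : α) :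
    DefOn U C fun _ _ _ v => ∀ x, terminal (v ∘ σ) (v ∘ τ) x ≠ v y :=
  (DefOn.forall_fin fun x => (defOn_eq (partVar σ τ Fin.elim0 (.inr x)) y).not).congr
    fun V G R _ v => forall_congr' fun x => by rw [terminal_comp σ τ Fin.elim0 v]

theorem defOn_admissible : DefOn U C fun _ _ _ v => Admissible (v ∘ σ) (v ∘ τ) (v ∘ ρ) :=
  (DefOn.forall_fin fun l => DefOn.forall_fin fun l' =>
    (defOn_eq (ρ l) (ρ l')).imp (defOn_const (l = l'))).and
    (DefOn.forall_fin fun l => defOn_not_terminal σ τ (ρ l))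

theorem defOn_usable (x : Fin n ⊕ (Fin j × Bool)) :
    DefOn U C fun _ G _ v => Usable G.graph (v ∘ σ) (v ∘ τ) (Sum.map (v ∘ ρ) id x) := by
  rcases x with l | x
  · exact defOn_not_terminal σ τ (ρ l)
  · exact defOn_needsPath σ τ x.1

/-- All copies belong to the part, so a neighbour outside it is a vertex of the graph and one
first-order quantifier finds it. -/
theorem defOn_boundary (x : Fin n ⊕ (Fin j × Bool)) :
    DefOn U C fun _ G _ v =>
      x ∈ boundary (linkGraph G.graph (v ∘ σ) (v ∘ τ)) (Sum.map (v ∘ ρ) id) := by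
  have h1 := (defOn_not_terminal (U := U) (C := C) (fun i => (Sum.inl (σ i) : α ⊕ Unit))
    (fun i => Sum.inl (τ i)) (Sum.inr ())).and <|
    (DefOn.forall_fin (U := U) (C := C) fun l : Fin n =>
      (defOn_eq (Sum.inl (ρ l) : α ⊕ Unit) (Sum.inr ())).not).and <|
    (defOn_adj (Sum.inl (partVar σ τ ρ x)) (Sum.inr ())).and <|
    defOn_usable (fun i => Sum.inl (σ i)) (fun i => Sum.inl (τ i)) (fun i => Sum.inl (ρ i)) x
  refine h1.exists_vertex.congr fun V G R _ v => ?_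
  constructor
  · rintro ⟨y, hyt, hya, hadj, hus⟩
    refine ⟨.inl y, ?_, ?_, hus, hyt, .inr rfl⟩
    · rintro ⟨l | z, hz⟩
      · exact hya l (Sum.inl_injective hz)
      · cases hz
    · rw [linkProj_comp]; exact hadj
  · rintro ⟨y | z, hy, hadj, hus, hyt, -⟩
    · refine ⟨y, hyt, fun l hl => hy ⟨.inl l, congrArg Sum.inl hl⟩, ?_, hus⟩
      rw [linkProj_comp] at hadj; exact hadj
    · exact absurd ⟨.inr z, rfl⟩ hy

theorem defOn_localTorso (x y : Fin n ⊕ (Fin j × Bool)) :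
    DefOn U C fun _ G _ v =>
      (localTorso (linkGraph G.graph (v ∘ σ) (v ∘ τ)) (Sum.map (v ∘ ρ) id)).Adj x y := by
  refine DefOn.or ?_ ((defOn_const (x ≠ y)).and
    ((defOn_boundary σ τ ρ x).and (defOn_boundary σ τ ρ y)))
  refine ((defOn_adj (partVar σ τ ρ x) (partVar σ τ ρ y)).and <| (defOn_usable σ τ ρ x).and <|
    (defOn_usable σ τ ρ y).and (defOn_const (x.isLeft ∨ y.isLeft))).congr fun V G R _ v => ?_
  simp only [linkGraph, linkProj_comp, Sum.isLeft_map]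

theorem defOn_locallyLinkable :
    DefOn U C fun _ G _ v => LocallyLinkable G.graph (v ∘ σ) (v ∘ τ) (v ∘ ρ) := by
  refine (DefOn.of_code (U := U) (C := C)
    (Q := Sum.elim (fun xy : (Fin n ⊕ (Fin j × Bool)) × (Fin n ⊕ (Fin j × Bool)) => fun V G R v =>
      (localTorso (linkGraph G.graph (v ∘ σ) (v ∘ τ)) (Sum.map (v ∘ ρ) id)).Adj xy.1 xy.2)
      fun i => fun V G R v => NeedsPath G.graph (v ∘ σ) (v ∘ τ) i)
    (Sum.rec (fun xy => defOn_localTorso σ τ ρ xy.1 xy.2) fun i => defOn_needsPath σ τ i)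
    -- The truth values only give a relation on the part; `T` is the graph that has it as adjacency.
    fun X => ∃ T : SimpleGraph (Fin n ⊕ (Fin j × Bool)),
      (∀ x y, T.Adj x y ↔ X (.inl (x, y))) ∧ Linkable T fun i => X (.inr i)).congr
    fun V G R _ v => ?_
  constructor
  · rintro ⟨T, hT, hl⟩
    have : T = localTorso (linkGraph G.graph (v ∘ σ) (v ∘ τ)) (Sum.map (v ∘ ρ) id) := by
      ext x y; exact hT x y
    subst this
    exact hl
  · exact fun hl => ⟨_, fun _ _ => Iff.rfl, hl⟩

theorem defOn_weight (F : ℕ → Prop) :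
    DefOn U C fun _ G _ v => F (weight G.graph (v ∘ σ) (v ∘ τ) (v ∘ ρ)) :=
  DefOn.of_code (fun x => defOn_boundary σ τ ρ x) fun X => F {x | X x}.ncard

theorem defOn_criterion (L : ℕ) :
    DefOn U C fun _ G _ v => Criterion L G.graph (v ∘ σ) (v ∘ τ) := by
  refine DefOn.exists_fin fun m => DefOn.and (DefOn.exists_fin fun n => ?_)
    (DefOn.forall_fin fun n => ?_)
  · exact DefOn.exists_tuple (P := fun V G R w => Admissible (w ∘ Sum.inl ∘ σ) (w ∘ Sum.inl ∘ τ)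
      (w ∘ Sum.inr) ∧ weight G.graph (w ∘ Sum.inl ∘ σ) (w ∘ Sum.inl ∘ τ) (w ∘ Sum.inr) ≤ m ∧
      LocallyLinkable G.graph (w ∘ Sum.inl ∘ σ) (w ∘ Sum.inl ∘ τ) (w ∘ Sum.inr))
      ((defOn_admissible _ _ _).and ((defOn_weight _ _ _ fun x => x ≤ m).and
        (defOn_locallyLinkable _ _ _)))
  · exact DefOn.forall_tuple (P := fun V G R w => Admissible (w ∘ Sum.inl ∘ σ) (w ∘ Sum.inl ∘ τ)
      (w ∘ Sum.inr) → m ≤ weight G.graph (w ∘ Sum.inl ∘ σ) (w ∘ Sum.inl ∘ τ) (w ∘ Sum.inr))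
      ((defOn_admissible _ _ _).imp (defOn_weight _ _ _ fun x => m ≤ x))

end Criterion
end Definability

/-! ### Definability of patterns and signatures -/

/-! ### Finiteness of the sets of atoms and of signature values -/

instance (r : ℕ) (Λ : Finset ℕ) : Finite (Arg r Λ) :=
  Finite.of_surjective (Sum.elim Arg.var Arg.root : Fin r ⊕ Λ → Arg r Λ) (by
    rintro (i | c)
    · exact ⟨.inl i, rfl⟩
    · exact ⟨.inr c, rfl⟩)

instance (k h r : ℕ) (Λ : Finset ℕ) : Finite (Atom k h Λ r) :=
  Finite.of_surjective
    (Sum.elim (fun x : Arg r Λ × Arg r Λ => .eq x.1 x.2) <|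
      Sum.elim (fun x : Arg r Λ × Arg r Λ => .edge x.1 x.2) <|
      Sum.elim (fun x : Fin h × Arg r Λ => .color x.1 x.2)
        fun x : Σ j : {j : Fin (k + 1) // 1 ≤ (j : ℕ)},
          (Fin j.1 → Arg r Λ) × (Fin j.1 → Arg r Λ) =>
          Atom.dp x.1.1 x.1.2 (Nat.lt_succ_iff.1 x.1.1.2) x.2.1 x.2.2) (by
    rintro (⟨a, b⟩ | ⟨a, b⟩ | ⟨i, a⟩ | ⟨j, h1, h2, s, t⟩)
    · exact ⟨.inl (a, b), rfl⟩
    · exact ⟨.inr (.inl (a, b)), rfl⟩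
    · exact ⟨.inr (.inr (.inl (i, a))), rfl⟩
    · exact ⟨.inr (.inr (.inr ⟨⟨⟨j, Nat.lt_succ_iff.2 h2⟩, h1⟩, s, t⟩)), rfl⟩)

instance finite_sigVal (k h : ℕ) (Λ : Finset ℕ) (i : ℕ) : ∀ m, Finite (SigVal k h Λ i m) := by
  induction i with
  | zero => exact fun m => inferInstanceAs (Finite (Set (Atom k h Λ m)))
  | succ i ih => exact fun m =>
      have := ih (m + 1)
      inferInstanceAs (Finite (Set (SigVal k h Λ i (m + 1))))

section Signatures

variable {h : ℕ} {Λ : Finset ℕ} {ι : Type}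
  {U : ∀ V : Type u, RootedGraph h Λ V → Set V → ι → Set V}
  {C : ∀ V : Type u, RootedGraph h Λ V → Prop} {α : Type} {m : ℕ}

/-- The variable, or the root, that an argument of an atomic formula stands for. -/
def argVar (e : Fin m → Option α) : Arg m Λ → Option (α ⊕ Λ)
  | .var i => (e i).map Sum.inl
  | .root c => some (Sum.inr c)

theorem argVal_eq (e : Fin m → Option α) {V : Type u} (G : RootedGraph h Λ V) (w : α ⊕ Λ → V)
    (hw : ∀ c, w (.inr c) = G.root c) (a : Arg m Λ) :
    a.val G (fun l => (e l).map (w ∘ Sum.inl)) = (argVar e a).map w := by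
  cases a with
  | var i => simp [Arg.val, argVar, Option.map_map]
  | root c => simp [Arg.val, argVar, hw]

theorem defOn_argEq (x y : Option α) : DefOn U C fun _ _ _ w => x.map w = y.map w := by
  rcases x with _ | x <;> rcases y with _ | y
  · exact (defOn_const True).congr fun _ _ _ _ _ => by simp
  · exact (defOn_const False).congr fun _ _ _ _ _ => by simp
  · exact (defOn_const False).congr fun _ _ _ _ _ => by simp
  · exact (defOn_eq x y).congr fun _ _ _ _ _ => by simp

theorem defOn_argAdj (x y : Option α) :
    DefOn U C fun _ G _ w => ∃ a b, x.map w = some a ∧ y.map w = some b ∧ G.graph.Adj a b := by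
  rcases x with _ | x <;> rcases y with _ | y
  · exact (defOn_const False).congr fun _ _ _ _ _ => by simp
  · exact (defOn_const False).congr fun _ _ _ _ _ => by simp
  · exact (defOn_const False).congr fun _ _ _ _ _ => by simp
  · exact (defOn_adj x y).congr fun _ _ _ _ _ => by simp

theorem defOn_argUnary (i : ι) (x : Option α) :
    DefOn U C fun V G R w => ∃ a, x.map w = some a ∧ a ∈ U V G R i := by
  rcases x with _ | x
  · exact (defOn_const False).congr fun _ _ _ _ _ => by simp
  · exact (defOn_unary i x).congr fun _ _ _ _ _ => by simp

theorem defOn_argCriterion (L : ℕ) {j : ℕ} (s t : Fin j → Option α) :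
    DefOn U C fun V G _ w => ∃ x y : Fin j → V, (∀ i, (s i).map w = some (x i)) ∧
      (∀ i, (t i).map w = some (y i)) ∧ Criterion L G.graph x y := by
  by_cases hs : (∃ σ : Fin j → α, ∀ i, s i = some (σ i)) ∧ ∃ τ : Fin j → α, ∀ i, t i = some (τ i)
  · obtain ⟨⟨σ, hσ⟩, τ, hτ⟩ := hs
    refine (defOn_criterion σ τ L).congr fun V G R _ w => ?_
    simp only [hσ, hτ, Option.map_some, Option.some.injEq]
    constructor
    · exact fun hc => ⟨_, _, fun _ => rfl, fun _ => rfl, hc⟩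
    · rintro ⟨x, y, hx, hy, hc⟩
      rwa [show w ∘ σ = x from funext hx, show w ∘ τ = y from funext hy]
  · refine (defOn_const False).congr fun V G R _ w => ⟨False.elim, ?_⟩
    rintro ⟨x, y, hx, hy, -⟩
    simp only [Option.map_eq_some_iff] at hx hy
    choose σ hσ using hx
    choose τ hτ using hy
    exact hs ⟨⟨σ, fun i => (hσ i).1⟩, τ, fun i => (hτ i).1⟩

variable {j₀ : Fin h ⊕ Λ → ι} {k L : ℕ}

theorem defOn_atom
    (hU : ∀ V G R i, U V G R (j₀ i) = G.unary i)
    (hdp : ∀ (V : Type u) (G : RootedGraph h Λ V), C V G → ∀ j, 1 ≤ j → j ≤ k →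
      ∀ s t : Fin j → V, DP G.graph s t ↔ Criterion L G.graph s t)
    (e : Fin m → Option α) (a : Atom k h Λ m) :
    ∃ Q : ∀ V : Type u, RootedGraph h Λ V → Set V → (α ⊕ Λ → V) → Prop, DefOn U C Q ∧
      ∀ V G R, C V G → ∀ w, (∀ c, w (.inr c) = G.root c) →
        (Q V G R w ↔ a.Holds G fun l => (e l).map (w ∘ Sum.inl)) := by
  cases a with
  | eq a b =>
    refine ⟨_, defOn_argEq (argVar e a) (argVar e b), fun V G R _ w hw => ?_⟩
    simp only [Atom.Holds, argVal_eq e G w hw]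
  | edge a b =>
    refine ⟨_, defOn_argAdj (argVar e a) (argVar e b), fun V G R _ w hw => ?_⟩
    simp only [Atom.Holds, argVal_eq e G w hw]
  | color i a =>
    refine ⟨_, defOn_argUnary (j₀ (.inl i)) (argVar e a), fun V G R _ w hw => ?_⟩
    simp only [Atom.Holds, argVal_eq e G w hw, hU]
    rfl
  | dp j h1 h2 s t =>
    refine ⟨_, defOn_argCriterion L (fun i => argVar e (s i)) (fun i => argVar e (t i)),
      fun V G R hC w hw => ?_⟩
    simp only [Atom.Holds, argVal_eq e G w hw, hdp V G hC j h1 h2]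

/-- Which entries are `⊥` is fixed by `e`, so no formula has to speak of `⊥`. The roots are
quantified existentially as extra variables and pinned down by their unary predicates. -/
theorem defOn_pattern
    (hU : ∀ V G R i, U V G R (j₀ i) = G.unary i)
    (hdp : ∀ (V : Type u) (G : RootedGraph h Λ V), C V G → ∀ j, 1 ≤ j → j ≤ k →
      ∀ s t : Fin j → V, DP G.graph s t ↔ Criterion L G.graph s t)
    (e : Fin m → Option α) (τ : Set (Atom k h Λ m)) :
    DefOn U C fun _ G _ v => pattern k G (fun l => (e l).map v) = τ := by
  choose Q hQ hQ' using fun a => defOn_atom hU hdp e (a := a)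
  refine (DefOn.exists_tuple (U := U) (C := C) ((DefOn.forall_fin fun c : Λ =>
    defOn_unary (j₀ (.inr c)) (Sum.inr c : α ⊕ Λ)).and
    (DefOn.forall_fin fun a => (hQ a).iff (defOn_const (a ∈ τ))))).congr fun V G R hC v => ?_
  constructor
  · rintro ⟨ρ, hρ, hτ⟩
    have hroot : ∀ c, ρ c = G.root c := fun c => by
      have := hρ c
      rw [hU] at this
      exact this
    ext a
    exact (hQ' a V G R hC (Sum.elim v ρ) hroot).symm.trans (hτ a)
  · rintro rfl
    refine ⟨fun c => G.root c, fun c => ?_, fun a => hQ' a V G R hC _ fun c => rfl⟩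
    rw [hU]
    rfl

/-- A signature is determined by which of the finitely many lower signatures occur in it. Each
occurs either for the entry `⊥`, which changes only `e`, or for some vertex of `R`, which adds one
quantified variable. -/
theorem defOn_sigAt
    (hU : ∀ V G R i, U V G R (j₀ i) = G.unary i)
    (hdp : ∀ (V : Type u) (G : RootedGraph h Λ V), C V G → ∀ j, 1 ≤ j → j ≤ k →
      ∀ s t : Fin j → V, DP G.graph s t ↔ Criterion L G.graph s t)
    {r₀ : ι} (hR : ∀ V G R, U V G R r₀ = R) (i : ℕ) : ∀ {α : Type} {m : ℕ}
    (e : Fin m → Option α) (σ : SigVal k h Λ i m),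
    DefOn U C fun _ G R v => sigAt k G R i m (fun l => (e l).map v) = σ := by
  induction i with
  | zero => exact fun e σ => defOn_pattern hU hdp e σ
  | succ i ih =>
    intro α m e σ
    have hnone := fun s => ih (Fin.snoc e none) s
    have hsome := fun s => ih
      (Fin.snoc (fun l => (e l).map Sum.inl) (some (Sum.inr ())) : Fin (m + 1) → Option (α ⊕ Unit)) s
    refine (DefOn.forall_fin fun s : SigVal k h Λ i (m + 1) => ((hnone s).or
      (DefOn.exists_vertex ((defOn_unary r₀ (Sum.inr ())).and (hsome s)))).iff
      (defOn_const (s ∈ (show Set (SigVal k h Λ i (m + 1)) from σ)))).congr fun V G R _ v => ?_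
    have h1 : (fun l => ((Fin.snoc e none : Fin (m + 1) → Option α) l).map v) =
        Fin.snoc (fun l => (e l).map v) none := by
      ext1 l
      refine Fin.lastCases ?_ (fun l => ?_) l <;> simp
    have h2 : ∀ x : V, (fun l => ((Fin.snoc (fun l => (e l).map Sum.inl) (some (Sum.inr ())) :
        Fin (m + 1) → Option (α ⊕ Unit)) l).map (Sum.elim v fun _ => x)) =
        Fin.snoc (fun l => (e l).map v) (some x) := by
      intro x
      ext1 l
      refine Fin.lastCases ?_ (fun l => ?_) l <;> simp [Option.map_map, Function.comp_def]
    have h3 : ∀ s, s ∈ (show Set (SigVal k h Λ i (m + 1)) from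
        sigAt k G R (i + 1) m fun l => (e l).map v) ↔
        (sigAt k G R i (m + 1) (Fin.snoc (fun l => (e l).map v) none) = s ∨
          ∃ x ∈ R, sigAt k G R i (m + 1) (Fin.snoc (fun l => (e l).map v) (some x)) = s) := by
      intro s
      constructor
      · rintro ⟨w, rfl | ⟨x, hx, rfl⟩, rfl⟩
        · exact .inl rfl
        · exact .inr ⟨x, hx, rfl⟩
      · rintro (rfl | ⟨x, hx, rfl⟩)
        · exact ⟨none, .inl rfl, rfl⟩
        · exact ⟨some x, .inr ⟨x, hx, rfl⟩, rfl⟩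
    simp only [h1, h2, hR, Sum.elim_inr]
    constructor
    · intro hs
      exact Set.ext fun s => (h3 s).trans (hs s)
    · rintro rfl s
      exact (h3 s).symm

end Signatures
end DPLogic

theorem mainTheorem3 (q : ℕ → ℕ) (k p L t : ℕ) (hp : p = 4 * k ^ 3) (hL : L = q p)
    (ht : t = max (6 * k ^ 3) (2 * k * L)) (h : ℕ) (Λ : Finset ℕ) (r : ℕ) :
    (∀ τ : Set (DPLogic.Atom k h Λ r),
      ∃ φ : (DPLogic.graphLang (Fin h ⊕ Λ)).Formula (Fin r),
        ∀ (V : Type u) [Finite V] (G : DPLogic.RootedGraph h Λ V),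
          DPLogic.Unbreakable G.graph L p →
          DPLogic.IsMinor (SimpleGraph.completeGraph (Fin t)) G.graph →
          ∀ v : Fin r → V,
            DPLogic.ModelsFO G φ v ↔ DPLogic.pattern k G (fun i => some (v i)) = τ) ∧
    (∀ σ : DPLogic.SigVal k h Λ r 0,
      ∃ φ : (DPLogic.graphLang (Option (Fin h ⊕ Λ))).Sentence,
        ∀ (V : Type u) [Finite V] (G : DPLogic.RootedGraph h Λ V),
          DPLogic.Unbreakable G.graph L p →
          DPLogic.IsMinor (SimpleGraph.completeGraph (Fin t)) G.graph →
          ∀ R : Set V, DPLogic.ModelsFOWith G R φ ↔ DPLogic.sig k r G R = σ) := by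
  -- Finiteness of the graph is made part of the class, since `DefOn` quantifies over all vertex
  -- types.
  let C : ∀ V : Type u, DPLogic.RootedGraph h Λ V → Prop := fun V G => Finite V ∧
    DPLogic.Unbreakable G.graph L p ∧
    DPLogic.IsMinor (SimpleGraph.completeGraph (Fin t)) G.graph
  have hdp : ∀ (V : Type u) (G : DPLogic.RootedGraph h Λ V), C V G → ∀ j, 1 ≤ j → j ≤ k →
      ∀ x y : Fin j → V, DPLogic.DP G.graph x y ↔ DPLogic.Criterion L G.graph x y := by
    rintro V G ⟨_, hU, hM⟩ j h1 h2 x y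
    exact DPLogic.dp_iff_criterion h1 h2 ht (hp ▸ hU) hM
  constructor
  · intro τ
    obtain ⟨φ, hφ⟩ := DPLogic.defOn_pattern (U := fun V G _ => G.unary) (C := C) (j₀ := id)
      (fun _ _ _ _ => rfl) hdp (fun l : Fin r => some l) τ
    exact ⟨φ, fun V _ G hU hM v => hφ V G ∅ ⟨inferInstance, hU, hM⟩ v⟩
  · intro σ
    obtain ⟨φ, hφ⟩ := DPLogic.defOn_sigAt (U := fun V G R => G.unaryWith R) (C := C) (j₀ := some)
      (fun _ _ _ _ => rfl) hdp (r₀ := none) (fun _ _ _ => rfl) r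
      (Fin.elim0 : Fin 0 → Option Empty) σ
    refine ⟨φ, fun V _ G hU hM R => ?_⟩
    have := hφ V G R ⟨inferInstance, hU, hM⟩ default
    beta_reduce at this
    rwa [show (fun l : Fin 0 => ((Fin.elim0 l : Option Empty)).map (default : Empty → V)) =
      Fin.elim0 from funext fun l => l.elim0] at this
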